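/- Let $R$ be an associative unital ring; "module" means right $R$-module. All classes of modules are closed under isomorphic images. Definitions. Let $\kappa$ be an infinite regular cardinal. A module $M$ is $<\!\kappa$-presented if there is an exact sequence $R^{(J)}\to R^{(I)}\to M\to 0$ with $|I|,|J|<\kappa$ (so $<\!\aleph_0$-presented means finitely presented). An epimorphism $\pi\colon B\to C$ is $\kappa$-pure if $\operatorname{Hom}_R(F,\pi)$ is surjective for every $<\!\kappa$-presented module $F$, and pure if it is $\aleph_0$-pure. A class $\mathcal A$ is closed under $\kappa$-pure-epimorphic images if $C\in\mathcal A$ whenever there is a $\kappa$-pure epimorphism $B\to C$ with $B\in\mathcal A$ (for $\kappa=\aleph_0$: closed under pure-epimorphic images). It is closed under direct limits if it contains the direct limit of each directed system of modules from $\mathcal A$. For a class $\mathcal C$ put $\mathcal C^\perp=\{M\mid \operatorname{Ext}^1_R(C,M)=0 \text{ for all } C\in\mathcal C\}$ and ${}^\perp\mathcal C=\{M\mid \operatorname{Ext}^1_R(M,C)=0\text{ for all } C\in\mathcal C\}$. A pair $(\mathcal A,\mathcal B)$ of classes is a cotorsion pair if $\mathcal A^\perp=\mathcal B$ and ${}^\perp\mathcal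 B=\mathcal A$; it is generated by a class $\mathcal S$ if $\mathcal B=\mathcal S^\perp$. A homomorphism $f\colon A\to M$ is an $\mathcal A$-cover of $M$ if $A\in\mathcal A$, each homomorphism $A'\to M$ with $A'\in\mathcal A$ factors through $f$, and each endomorphism $e$ of $A$ with $fe=f$ is an automorphism. The class $\mathcal A$ is covering if every module has an $\mathcal A$-cover. Statement. 1. Let $\kappa$ be an infinite regular cardinal and let $(\mathcal A,\mathcal B)$ be a cotorsion pair generated by a class of $<\!\kappa$-presented modules. If $\mathcal A$ is covering, then $\mathcal A$ is closed under $\kappa$-pure-epimorphic images. 2. Let $(\mathcal A,\mathcal B)$ be a cotorsion pair generated by a class of finitely presented modules. Then $\mathcal A$ is covering if and only if it is closed under pure-epimorphic images, if and only if it is closed under direct limits. -/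

import Mathlib

open CategoryTheory

universe u

namespace CotorsionPairs

/-- `M` is `<κ`-presented: there is an exact sequence `S^(J) → S^(I) → M → 0` of `S`-modules with
`|I|, |J| < κ`; that is, `M` has fewer than `κ` generators subject to fewer than `κ` relations. -/
def IsLTPresented (S : Type u) [Ring S] (κ : Cardinal.{u}) (M : Type u) [AddCommGroup M]
    [Module S M] : Prop :=
  ∃ (I : Type u) (f : (I →₀ S) →ₗ[S] M) (X : Set (I →₀ S)),
    Cardinal.mk I < κ ∧ Cardinal.mk X < κ ∧
      Function.Surjective f ∧ Submodule.span S X = LinearMap.ker f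

/-- The `<ℵ₀`-presented modules are the finitely presented ones. -/
theorem isLTPresented_aleph0_iff (S : Type u) [Ring S] (M : Type u) [AddCommGroup M]
    [Module S M] : IsLTPresented S Cardinal.aleph0 M ↔ Module.FinitePresentation S M := by
  constructor
  · rintro ⟨I, f, X, hI, hX, hf, hX2⟩
    have : Finite I := Cardinal.lt_aleph0_iff_finite.mp hI
    refine Module.finitePresentation_of_free_of_surjective f hf ?_
    rw [← hX2]
    exact Submodule.fg_span (Cardinal.lt_aleph0_iff_set_finite.mp hX)
  · rintro ⟨s, hs, t, ht⟩
    refine ⟨s, Finsupp.linearCombination S ((↑) : s → M), t, ?_, ?_, ?_, ht⟩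
    · exact Cardinal.lt_aleph0_iff_finite.mpr inferInstance
    · exact Cardinal.lt_aleph0_iff_finite.mpr inferInstance
    · rw [← LinearMap.range_eq_top, Finsupp.range_linearCombination]
      simpa using hs

section

variable {S : Type u} [Ring S]

/-- An epimorphism `π` is `κ`-pure if `Hom(F, π)` is surjective for all `<κ`-presented `F`. -/
def IsPureEpi (κ : Cardinal.{u}) {B C : ModuleCat.{u} S} (π : B ⟶ C) : Prop :=
  Epi π ∧ ∀ F : ModuleCat.{u} S, IsLTPresented S κ F →
    ∀ g : F ⟶ C, ∃ h : F ⟶ B, h ≫ π = g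

/-- The class `𝒞^⊥` of all `M` with `Ext¹(C, M) = 0` for all `C ∈ 𝒞`. -/
def rightPerp (𝒞 : ObjectProperty (ModuleCat.{u} S)) : ObjectProperty (ModuleCat.{u} S) :=
  fun M => ∀ C : ModuleCat.{u} S, 𝒞 C → Subsingleton (Abelian.Ext C M 1)

/-- The class `^⊥𝒞` of all `M` with `Ext¹(M, C) = 0` for all `C ∈ 𝒞`. -/
def leftPerp (𝒞 : ObjectProperty (ModuleCat.{u} S)) : ObjectProperty (ModuleCat.{u} S) :=
  fun M => ∀ C : ModuleCat.{u} S, 𝒞 C → Subsingleton (Abelian.Ext M C 1)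

/-- `(𝒜, ℬ)` is a cotorsion pair. -/
def IsCotorsionPair (𝒜 ℬ : ObjectProperty (ModuleCat.{u} S)) : Prop :=
  rightPerp 𝒜 = ℬ ∧ leftPerp ℬ = 𝒜

/-- `(𝒜, ℬ)` is a cotorsion pair generated by the class `𝒢`. -/
def IsCotorsionPairGeneratedBy (𝒢 𝒜 ℬ : ObjectProperty (ModuleCat.{u} S)) : Prop :=
  IsCotorsionPair 𝒜 ℬ ∧ ℬ = rightPerp 𝒢

/-- `f : C ⟶ M` is a `𝒞`-precover of `M`. -/
def IsPrecover (𝒞 : ObjectProperty (ModuleCat.{u} S)) {C M : ModuleCat.{u} S} (f : C ⟶ M) :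
    Prop :=
  𝒞 C ∧ ∀ D : ModuleCat.{u} S, 𝒞 D → ∀ g : D ⟶ M, ∃ h : D ⟶ C, h ≫ f = g

/-- `f : C ⟶ M` is a `𝒞`-cover of `M`: a precover such that every endomorphism of `C` compatible
with `f` is an automorphism. -/
def IsCover (𝒞 : ObjectProperty (ModuleCat.{u} S)) {C M : ModuleCat.{u} S} (f : C ⟶ M) : Prop :=
  IsPrecover 𝒞 f ∧ ∀ e : C ⟶ C, e ≫ f = f → IsIso e

/-- The class `𝒞` is covering: each module has a `𝒞`-cover. -/
def IsCovering (𝒞 : ObjectProperty (ModuleCat.{u} S)) : Prop :=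
  ∀ M : ModuleCat.{u} S, ∃ (C : ModuleCat.{u} S) (f : C ⟶ M), IsCover 𝒞 f

/-- The class `𝒞` is closed under `κ`-pure-epimorphic images. -/
def IsClosedUnderPureEpiImages (κ : Cardinal.{u}) (𝒞 : ObjectProperty (ModuleCat.{u} S)) : Prop :=
  ∀ (B C : ModuleCat.{u} S) (π : B ⟶ C), IsPureEpi κ π → 𝒞 B → 𝒞 C

/-- The class `𝒞` is closed under direct limits, that is, under colimits of directed systems
indexed by nonempty upward directed posets. -/
def IsClosedUnderDirectLimits (𝒞 : ObjectProperty (ModuleCat.{u} S)) : Prop :=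
  ∀ (I : Type u) [PartialOrder I] [IsDirectedOrder I] [Nonempty I],
    𝒞.IsClosedUnderColimitsOfShape I

end

end CotorsionPairs

/-! Let π : B → C be κ-pure with B ∈ 𝒜, and let f : A → C be an 𝒜-cover. Then π factors through f,
so f is an epimorphism along which maps from `<κ`-presented modules lift, and K = ker f lies in ℬ by
Wakamatsu's lemma. It is enough to find, for each x ∈ K, a map g : A → K with g(x) = x. Then 1 - g
is an endomorphism of A over C, hence an automorphism, and it kills x; thus K = 0 and C ≅ A.

To find g, A is split off from a complex built out of free modules on the generators of
`<κ`-presented modules in ^⊥ℬ, attached along their relations. The projection of this complex to A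
has kernel in ℬ, so it has a section s. The element s(x) lives on a subcomplex D with fewer than κ
generators. The module on D modulo its relations and s(x) is `<κ`-presented and maps to C, since
f(x) = 0; this map lifts to h with values in A. The projection minus h maps D to K and sends s(x) to
x. As K ∈ ℬ, it extends over all cells, and composing with s gives g (`exists_hom_ker_apply_eq`).

For κ = ℵ₀, a direct limit is a pure-epimorphic image of the direct sum of the system. Conversely,
closure under direct limits gives covers (Enochs): the complex over M is a precover, and its
endomorphisms over M form a monoid in which linearly ordered systems have cocones. Such a monoid
contains an idempotent x for which xGx is a group (`HasMonoidCocones.exists_idempotent`), and the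
image of x is the cover. -/

namespace CotorsionPairs

/-! ### Monoids with cocones -/

/-- A cocone over a system in a monoid indexed by a linear order. -/
def HasMonoidCocones (G : Type u) [Monoid G] : Prop :=
  ∀ (W : Type u) [LinearOrder W] [Nonempty W] (e : W → W → G),
    (∀ a b c, a < b → b < c → e b c * e a b = e a c) →
      ∃ r : W → G, ∀ a b, a < b → r b * e a b = r a

/-- Over a well-order, there is a system whose transition maps into `b` factor through a cocone of
the system below `b`, followed by a prescribed element. -/
theorem HasMonoidCocones.exists_system {G : Type u} [Monoid G] (hG : HasMonoidCocones G)
    {W : Type u} [LinearOrder W] [WellFoundedLT W] (o : W) (c : G → G) :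
    ∃ (e r : W → W → G), (∀ a b d, a < b → b < d → e b d * e a b = e a d) ∧
      (∀ a b d, a < b → b < d → r b d * e a b = r a d) ∧
      ∀ a b, e a b = c (r o b) * r a b := by
  classical
  let P : ∀ b : W, (∀ d, d < b → W → G) → (W → G) → Prop := fun b prev r =>
    ∀ a a' (h : a' < b), a < a' → r a' * prev a' h a = r a
  -- Recursion on `b`: `R` picks a cocone over the system already built below `b`. That one exists
  -- follows only from the induction in `key`, so a default is needed here.
  let R : ∀ b : W, (∀ d, d < b → W → G) → W → G := fun b prev =>
    if h : ∃ r, P b prev r then h.choose else fun _ => 1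
  let E : W → W → G := wellFounded_lt.fix (fun b prev a => c (R b prev o) * R b prev a)
  have hE : ∀ b, E b = fun a => c (R b (fun d _ => E d) o) * R b (fun d _ => E d) a := by
    intro b
    exact wellFounded_lt.fix_eq (fun b prev a => c (R b prev o) * R b prev a) b
  have key : ∀ d, (∀ a b, a < b → b < d →
      R d (fun d _ => E d) b * E b a = R d (fun d _ => E d) a) := by
    intro d
    induction d using WellFoundedLT.induction with
    | ind d ih =>
      have hco : ∀ a b b', a < b → b < b' → b' < d → E b' b * E b a = E b' a := by
        intro a b b' h1 h2 h3
        rw [hE b']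
        simp only [mul_assoc]
        rw [ih b' h3 a b h1 h2]
      have : ∃ r, P d (fun d _ => E d) r := by
        by_cases hne : Nonempty (Set.Iio d)
        · obtain ⟨r, hr⟩ := hG (Set.Iio d) (fun a b => E b a)
            (fun a b c hab hbc => hco a b c hab hbc c.2)
          refine ⟨fun a => if h : a < d then r ⟨a, h⟩ else 1, fun a a' h haa' => ?_⟩
          simp only [h, haa'.trans h, dite_true]
          exact hr ⟨a, haa'.trans h⟩ ⟨a', h⟩ haa'
        · exact ⟨fun _ => 1, fun a a' h _ => (hne ⟨⟨a', h⟩⟩).elim⟩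
      intro a b hab hbd
      have hR : R d (fun d _ => E d) = this.choose := dif_pos this
      rw [hR]
      exact this.choose_spec a b hbd hab
  refine ⟨fun a b => E b a, fun a b => R b (fun d _ => E d) a, ?_, ?_, ?_⟩
  · intro a b d hab hbd
    simp only
    rw [hE d]
    simp only [mul_assoc]
    rw [key d a b hab hbd]
  · intro a b d hab hbd
    exact key d a b hab hbd
  · intro a b
    exact congrFun (hE b) a

/-- A monoid with cocones has an idempotent whose local monoid is a group. -/
theorem HasMonoidCocones.exists_idempotent {G : Type u} [Monoid G] (hG : HasMonoidCocones G) :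
    ∃ x : G, x * x = x ∧ ∀ g, x * g = g → g * x = g →
      ∃ h, h * g = x ∧ g * h = x ∧ x * h = h ∧ h * x = h := by
  classical
  obtain ⟨W, _, hW⟩ : ∃ W : Type u, Nonempty W ∧
      ∀ F : W → Option (G ⊕ G), ¬ Function.Injective F :=
    ⟨Set (Option (G ⊕ G)), inferInstance, Function.cantor_injective⟩
  obtain ⟨_, _⟩ := exists_wellFoundedLT W
  obtain ⟨o, -, ho⟩ := (wellFounded_lt (α := W)).has_min Set.univ Set.univ_nonempty
  have ho : ∀ b, b ≠ o → o < b := fun b hb =>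
    lt_of_le_of_ne (not_lt.1 (ho b trivial)) (Ne.symm hb)
  -- If the left ideal `Gx` is not minimal, `c x` is a `y` with `x ∉ Gyx`; otherwise it is `x`
  -- itself.
  let c : G → G := fun x => if h : ∃ y, ∀ z, z * y * x ≠ x then h.choose else x
  obtain ⟨e, r, he, hr, hc⟩ := hG.exists_system o c
  obtain ⟨R, hR⟩ := hG W e he
  let good : W → Prop := fun b => ¬ ∃ y, ∀ z, z * y * r o b ≠ r o b
  -- Pigeonhole: `F` must repeat a value. A repeated `r o a = r o b` at indices that are not good
  -- would return from `y * r o a` to `r o a`, against the choice of `y`. So the repetition is one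
  -- of `R` at good indices.
  let F : W → Option (G ⊕ G) := fun b =>
    if b = o then none else if good b then some (.inr (R b)) else some (.inl (r o b))
  have hF : ¬ Function.Injective F := hW F
  obtain ⟨a, b, hab, hgood, ho', hRab⟩ : ∃ a b, a < b ∧ good b ∧ o < a ∧ R a = R b := by
    by_contra hcon
    push Not at hcon
    apply hF
    have : ∀ a b, a < b → F a ≠ F b := by
      intro a b hab h
      have hb : b ≠ o := by
        rintro rfl
        have := ho a hab.ne
        exact lt_asymm this hab
      by_cases ha : a = o
      · simp only [F, ha, hb, if_true, if_false] at h
        split_ifs at h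
      · by_cases hga : good a <;> by_cases hgb : good b <;>
          simp only [F, ha, hb, hga, hgb, if_true, if_false, Option.some.injEq, reduceCtorEq,
            Sum.inr.injEq, Sum.inl.injEq] at h
        · exact hcon a b hab hgb (ho a ha) h
        · have hga' : ∃ y, ∀ z, z * y * r o a ≠ r o a := not_not.1 hga
          have h1 := hr o a b (ho a ha) hab
          have h2 : c (r o a) = hga'.choose := dif_pos hga'
          rw [hc, h2, ← mul_assoc, ← h] at h1
          exact hga'.choose_spec _ h1
    intro a b h
    rcases lt_trichotomy a b with h' | h' | h'
    · exact (this a b h' h).elim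
    · exact h'
    · exact (this b a h' h.symm).elim
  have hcb : c (r o b) = r o b := dif_neg hgood
  have hx : e a b = r o b * r a b := by rw [hc, hcb]
  have hmin : ∀ y, ∃ z, z * y * r o b = r o b := by
    intro y
    by_contra h
    push Not at h
    exact hgood ⟨y, h⟩
  have hleft : ∀ g, g * e a b = g → ∃ z, z * g = e a b := by
    intro g hg
    obtain ⟨z, hz⟩ := hmin g
    refine ⟨z, ?_⟩
    rw [← hg, hx, ← mul_assoc, ← mul_assoc, hz]
  have hidem : e a b * e a b = e a b := by
    have h1 := hR a b hab
    rw [hRab] at h1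
    obtain ⟨z, hz⟩ := hleft _ h1
    calc e a b * e a b = z * R b * e a b := by rw [hz]
      _ = e a b := by rw [mul_assoc, h1, hz]
  generalize e a b = x at *
  -- Every element of `xGx` has a left inverse in `xGx`, which makes it a group.
  have hloc : ∀ g, x * g = g → g * x = g → ∃ h, h * g = x ∧ x * h = h ∧ h * x = h := by
    intro g h1 h2
    obtain ⟨z, hz⟩ := hleft g h2
    refine ⟨x * z * x, ?_, ?_, ?_⟩
    · rw [mul_assoc, h1, mul_assoc, hz, hidem]
    · rw [← mul_assoc, ← mul_assoc, hidem]
    · rw [mul_assoc, hidem]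
  refine ⟨x, hidem, fun g h1 h2 => ?_⟩
  obtain ⟨h, h3, h4, h5⟩ := hloc g h1 h2
  obtain ⟨k, h6, h7, h8⟩ := hloc h h4 h5
  refine ⟨h, h3, ?_, h4, h5⟩
  have : k = g := by rw [← h8, ← h3, ← mul_assoc, h6, h1]
  rw [← this, h6]

/-! ### Cell complexes: all stages of the small object argument in one inductive type -/

section Cells

set_option linter.unusedSectionVars false

variable {S : Type u} [Ring S] {ι : Type u} {X T : ι → Type u} {A : Type u} [AddCommGroup A]
  [Module S A]

/-- Generators of a cell complex over `A`: the basis elements `x : X i` of cells which are attached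
along finite linear combinations of generators constructed before, and are sent to `A` by `a`. -/
inductive Gen (S : Type u) (X T : ι → Type u) (A : Type u) : Type u
  | mk (i : ι) (a : X i → A) (n : T i → ℕ) (c : ∀ t, Fin (n t) → S)
      (g : ∀ t, Fin (n t) → Gen S X T A) (x : X i) : Gen S X T A

namespace Gen

/-- The map to `A` on generators. -/
def toBase : Gen S X T A → A
  | mk _ a _ _ _ x => a x

/-- The element to which a relation of a cell is attached. -/
noncomputable def attach {i : ι} {n : T i → ℕ} (c : ∀ t, Fin (n t) → S)
    (g : ∀ t, Fin (n t) → Gen S X T A) (t : T i) : Gen S X T A →₀ S :=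
  ∑ k, Finsupp.single (g t k) (c t k)

variable (r : ∀ i, T i → (X i →₀ S))

/-- The relation which attaches a cell. -/
noncomputable def attachRel {i : ι} (a : X i → A) {n : T i → ℕ} (c : ∀ t, Fin (n t) → S)
    (g : ∀ t, Fin (n t) → Gen S X T A) (t : T i) : Gen S X T A →₀ S :=
  Finsupp.lmapDomain S S (mk i a n c g) (r i t) - attach c g t

/-- The relations of the cell complex: the least submodule which contains the attaching relations of
each cell whose attaching map is well defined modulo that submodule and compatible with the map
to `A`. -/
inductive Rel : (Gen S X T A →₀ S) → Prop
  | zero : Rel 0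
  | add (v w : Gen S X T A →₀ S) : Rel v → Rel w → Rel (v + w)
  | smul (s : S) (v : Gen S X T A →₀ S) : Rel v → Rel (s • v)
  | attach (i : ι) (a : X i → A) (n : T i → ℕ) (c : ∀ t, Fin (n t) → S)
      (g : ∀ t, Fin (n t) → Gen S X T A)
      (hz : ∀ z : T i →₀ S, Finsupp.linearCombination S (r i) z = 0 →
        Rel (Finsupp.linearCombination S (attach c g) z))
      (ha : ∀ t, Finsupp.linearCombination S a (r i t) =
        Finsupp.linearCombination S toBase (attach c g t)) (t : T i) :
      Rel (attachRel r a c g t)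

/-- The submodule of relations. -/
def relSubmodule : Submodule S (Gen S X T A →₀ S) where
  carrier := {v | Rel r v}
  zero_mem' := Rel.zero
  add_mem' := Rel.add _ _
  smul_mem' s v := Rel.smul s v

/-- The validity condition for a cell. -/
def IsValid {i : ι} (a : X i → A) {n : T i → ℕ} (c : ∀ t, Fin (n t) → S)
    (g : ∀ t, Fin (n t) → Gen S X T A) : Prop :=
  (∀ z : T i →₀ S, Finsupp.linearCombination S (r i) z = 0 →
    Finsupp.linearCombination S (attach c g) z ∈ relSubmodule r) ∧
  ∀ t, Finsupp.linearCombination S a (r i t) = Finsupp.linearCombination S toBase (attach c g t)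

theorem linearCombination_lmapDomain {Y : Type u} [AddCommGroup Y] [Module S Y]
    (v : Gen S X T A → Y) {i : ι} (f : X i → Gen S X T A) (y : X i →₀ S) :
    Finsupp.linearCombination S v (Finsupp.lmapDomain S S f y) =
      Finsupp.linearCombination S (v ∘ f) y := by
  rw [Finsupp.lmapDomain_apply, Finsupp.linearCombination_mapDomain]

theorem relSubmodule_le_ker :
    relSubmodule r ≤ LinearMap.ker (Finsupp.linearCombination S (toBase (S := S) (X := X) (T := T)
      (A := A))) := by
  intro v hv
  induction hv with
  | zero => simp
  | add v w _ _ h1 h2 => exact add_mem h1 h2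
  | smul s v _ h => exact Submodule.smul_mem _ s h
  | attach i a n c g _ ha t _ =>
    rw [LinearMap.mem_ker, attachRel, map_sub, linearCombination_lmapDomain, ← ha, sub_eq_zero]
    rfl

/-- The cell complex. -/
abbrev Complex : Type u := (Gen S X T A →₀ S) ⧸ relSubmodule (A := A) r

/-- The map of the cell complex to `A`. -/
noncomputable def proj : Complex (A := A) r →ₗ[S] A :=
  (relSubmodule r).liftQ _ (relSubmodule_le_ker r)

theorem proj_mk (v : Gen S X T A →₀ S) :
    proj r ((relSubmodule r).mkQ v) = Finsupp.linearCombination S toBase v := by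
  rw [proj, Submodule.mkQ_apply, Submodule.liftQ_apply]

theorem mkQ_attachRel {i : ι} {a : X i → A} {n : T i → ℕ} {c : ∀ t, Fin (n t) → S}
    {g : ∀ t, Fin (n t) → Gen S X T A} (h : IsValid r a c g) (t : T i) :
    attachRel r a c g t ∈ relSubmodule r :=
  Rel.attach i a n c g h.1 h.2 t

/-- A set of generators closed under passing to the generators needed to attach their cells. -/
structure IsClosedSet (D : Set (Gen S X T A)) : Prop where
  cell : ∀ i a n c g x x', mk i a n c g x ∈ D → mk i a n c g x' ∈ D
  attach : ∀ i a n c g x t k, mk i a n c g x ∈ D → g t k ∈ D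

/-- An extension property: lifts along `q` extend from the relations to the free module. -/
def LiftsExtend {Y W : Type u} [AddCommGroup Y] [Module S Y] [AddCommGroup W] [Module S W]
    (q : Y →ₗ[S] W) : Prop :=
  ∀ (i : ι) (w : (X i →₀ S) →ₗ[S] W) (v : T i → Y),
    (∀ z : T i →₀ S, Finsupp.linearCombination S (r i) z = 0 →
      Finsupp.linearCombination S v z = 0) →
    (∀ t, q (v t) = w (r i t)) →
    ∃ ψ : (X i →₀ S) →ₗ[S] Y, q ∘ₗ ψ = w ∧ ∀ t, ψ (r i t) = v t

section Extend

variable {Y W : Type u} [AddCommGroup Y] [Module S Y] [AddCommGroup W] [Module S W]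
  (q : Y →ₗ[S] W) (w : Gen S X T A → W) (D : Set (Gen S X T A)) (v₀ : Gen S X T A → Y)

open Classical in
/-- The values on generators of an extension of a partial lift. -/
noncomputable def extendVal : Gen S X T A → Y
  | mk i a n c g x =>
    if mk i a n c g x ∈ D then v₀ (mk i a n c g x)
    else if h : ∃ ψ : (X i →₀ S) →ₗ[S] Y,
        q ∘ₗ ψ = Finsupp.linearCombination S (w ∘ mk i a n c g) ∧
        ∀ t, ψ (r i t) = ∑ k, c t k • extendVal (g t k)
      then h.choose (Finsupp.single x 1)
      -- Valid cells never come here, and an invalid cell attaches no relation, so any preimage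
      -- serves.
      else Function.invFun q (w (mk i a n c g x))

variable {q w D v₀}

theorem extendVal_of_mem {γ : Gen S X T A} (h : γ ∈ D) : extendVal r q w D v₀ γ = v₀ γ := by
  cases γ
  rw [extendVal, if_pos h]

theorem map_extendVal (hq : Function.Surjective q) (hv : ∀ γ ∈ D, q (v₀ γ) = w γ)
    (γ : Gen S X T A) : q (extendVal r q w D v₀ γ) = w γ := by
  classical
  cases γ with
  | mk i a n c g x =>
    rw [extendVal]
    split_ifs with h h'
    · exact hv _ h
    · have := LinearMap.congr_fun h'.choose_spec.1 (Finsupp.single x 1)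
      simpa using this
    · exact Function.invFun_eq (hq _)

theorem linearCombination_attach (v : Gen S X T A → Y) {i : ι} {n : T i → ℕ}
    (c : ∀ t, Fin (n t) → S) (g : ∀ t, Fin (n t) → Gen S X T A) (t : T i) :
    Finsupp.linearCombination S v (attach c g t) = ∑ k, c t k • v (g t k) := by
  simp [attach, map_sum]

theorem linearCombination_linearCombination_attach (v : Gen S X T A → Y) {i : ι} {n : T i → ℕ}
    (c : ∀ t, Fin (n t) → S) (g : ∀ t, Fin (n t) → Gen S X T A) (z : T i →₀ S) :
    Finsupp.linearCombination S v (Finsupp.linearCombination S (attach c g) z) =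
      Finsupp.linearCombination S (fun t => ∑ k, c t k • v (g t k)) z := by
  rw [Finsupp.linearCombination_apply S (v := attach c g), Finsupp.sum, map_sum,
    Finsupp.linearCombination_apply, Finsupp.sum]
  simp [linearCombination_attach]

/-- Induction on the derivation of a relation. A closed set contains a cell together with its
attaching generators or misses the cell entirely, so either `v₀` settles the relation or
`LiftsExtend` does; the induction hypothesis supplies the compatibility that the latter needs. -/
theorem linearCombination_extendVal (hq : Function.Surjective q) (hr : LiftsExtend r q)
    (hw : ∀ v ∈ relSubmodule (A := A) r, Finsupp.linearCombination S w v = 0)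
    (hD : IsClosedSet D) (hv : ∀ γ ∈ D, q (v₀ γ) = w γ)
    (hv₀ : ∀ i a n c g x, mk i a n c g x ∈ D → IsValid r a c g → ∀ t,
      Finsupp.linearCombination S v₀ (attachRel r a (n := n) c g t) = 0)
    (v : Gen S X T A →₀ S) (hmem : v ∈ relSubmodule r) :
    Finsupp.linearCombination S (extendVal r q w D v₀) v = 0 := by
  classical
  induction hmem with
  | zero => simp
  | add v w _ _ h1 h2 => rw [map_add, h1, h2, add_zero]
  | smul s v _ h => rw [map_smul, h, smul_zero]
  | attach i a n c g hz ha t ih =>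
    have hvalid : IsValid r a c g := ⟨hz, ha⟩
    by_cases hx : ∃ x, mk i a n c g x ∈ D
    · obtain ⟨x, hx⟩ := hx
      rw [← hv₀ i a n c g x hx hvalid t, attachRel, map_sub, map_sub,
        linearCombination_lmapDomain, linearCombination_lmapDomain, linearCombination_attach,
        linearCombination_attach]
      have h1 : extendVal r q w D v₀ ∘ mk i a n c g = v₀ ∘ mk i a n c g :=
        funext fun x' => extendVal_of_mem r (hD.cell _ _ _ _ _ _ _ hx)
      have h2 : ∀ k, extendVal r q w D v₀ (g t k) = v₀ (g t k) :=
        fun k => extendVal_of_mem r (hD.attach _ _ _ _ _ _ _ _ hx)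
      simp only [h1, h2]
    · have hex : ∃ ψ : (X i →₀ S) →ₗ[S] Y,
          q ∘ₗ ψ = Finsupp.linearCombination S (w ∘ mk i a n c g) ∧
          ∀ t, ψ (r i t) = ∑ k, c t k • extendVal r q w D v₀ (g t k) := by
        refine hr i _ _ (fun z hz' => ?_) (fun t => ?_)
        · rw [← ih z hz', linearCombination_linearCombination_attach]
        · have h1 := hw _ (mkQ_attachRel r hvalid t)
          rw [attachRel, map_sub, linearCombination_lmapDomain, linearCombination_attach,
            sub_eq_zero] at h1
          rw [h1, map_sum]
          simp [map_extendVal r hq hv]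
      have h1 : extendVal r q w D v₀ ∘ mk i a n c g = fun x => hex.choose (Finsupp.single x 1) := by
        funext x
        rw [Function.comp_apply, extendVal, if_neg (fun h => hx ⟨x, h⟩), dif_pos hex]
      have h2 : Finsupp.linearCombination S (fun x => hex.choose (Finsupp.single x 1)) =
          hex.choose := by
        ext x
        simp
      rw [attachRel, map_sub, linearCombination_lmapDomain, h1, h2, hex.choose_spec.2,
        linearCombination_attach, sub_self]

/-- Used with `D = ∅` to put the complex in `^⊥ℬ`, and with zero target to extend maps from a
subcomplex to a module in `ℬ`. -/
theorem exists_extend (hq : Function.Surjective q) (hr : LiftsExtend r q)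
    (φ : Complex (A := A) r →ₗ[S] W) (hD : IsClosedSet D)
    (hv : ∀ γ ∈ D, q (v₀ γ) = φ ((relSubmodule r).mkQ (Finsupp.single γ 1)))
    (hv₀ : ∀ i a n c g x, mk i a n c g x ∈ D → IsValid r a c g → ∀ t,
      Finsupp.linearCombination S v₀ (attachRel r a (n := n) c g t) = 0) :
    ∃ ψ : Complex (A := A) r →ₗ[S] Y, q ∘ₗ ψ = φ ∧
      ∀ γ ∈ D, ψ ((relSubmodule r).mkQ (Finsupp.single γ 1)) = v₀ γ := by
  let w : Gen S X T A → W := fun γ => φ ((relSubmodule r).mkQ (Finsupp.single γ 1))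
  have hw' : Finsupp.linearCombination S w = φ ∘ₗ (relSubmodule r).mkQ := by
    ext γ
    simp [w]
  have hw : ∀ v ∈ relSubmodule (A := A) r, Finsupp.linearCombination S w v = 0 := by
    intro v hv
    rw [hw', LinearMap.comp_apply, Submodule.mkQ_apply, (Submodule.Quotient.mk_eq_zero _).2 hv,
      map_zero]
  have hle : relSubmodule r ≤ LinearMap.ker
      (Finsupp.linearCombination S (extendVal r q w D v₀)) := fun v hv' =>
    LinearMap.mem_ker.2 (linearCombination_extendVal r hq hr hw hD hv hv₀ v hv')
  refine ⟨(relSubmodule r).liftQ _ hle, ?_, fun γ hγ => ?_⟩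
  · ext γ
    have := map_extendVal r (w := w) hq hv γ
    simpa [w] using this
  · rw [Submodule.mkQ_apply, Submodule.liftQ_apply, Finsupp.linearCombination_single, one_smul,
      extendVal_of_mem r hγ]

end Extend

theorem exists_attach_eq {i : ι} (v : T i → (Gen S X T A →₀ S)) :
    ∃ (n : T i → ℕ) (c : ∀ t, Fin (n t) → S) (g : ∀ t, Fin (n t) → Gen S X T A),
      attach c g = v := by
  refine ⟨fun t => (v t).support.card, fun t k => v t ((v t).support.equivFin.symm k),
    fun t k => ((v t).support.equivFin.symm k), funext fun t => ?_⟩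
  rw [attach, (v t).support.equivFin.symm.sum_comp
    (fun y => Finsupp.single (y : Gen S X T A) (v t y)),
    Finset.sum_coe_sort _ (fun y => Finsupp.single y (v t y))]
  exact Finsupp.sum_single (v t)

/-- Each cell with values in the kernel of the projection can be filled in the kernel. -/
theorem exists_extend_ker (i : ι) (v : T i → LinearMap.ker (proj (A := A) r))
    (hv : ∀ z : T i →₀ S, Finsupp.linearCombination S (r i) z = 0 →
      Finsupp.linearCombination S v z = 0) :
    ∃ ψ : (X i →₀ S) →ₗ[S] LinearMap.ker (proj (A := A) r), ∀ t, ψ (r i t) = v t := by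
  choose v' hv' using fun t => (relSubmodule (A := A) r).mkQ_surjective (v t : Complex r)
  obtain ⟨n, c, g, hatt⟩ := exists_attach_eq (A := A) v'
  have hlin : ∀ z : T i →₀ S, (relSubmodule r).mkQ (Finsupp.linearCombination S (attach c g) z) =
      Finsupp.linearCombination S v z := by
    intro z
    rw [hatt]
    simp only [Finsupp.linearCombination_apply, Finsupp.sum, map_sum, map_smul, hv']
    simp
  -- The values lie in the kernel, so the cell may be sent to `0` in `A`; its generators then lie in
  -- the kernel as well.
  have hvalid : IsValid r (fun _ => (0 : A)) c g := by
    refine ⟨fun z hz => ?_, fun t => ?_⟩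
    · have := hlin z
      rwa [hv z hz, ZeroMemClass.coe_zero, Submodule.mkQ_apply,
        Submodule.Quotient.mk_eq_zero] at this
    · have h1 : proj r (v t).1 = 0 := (v t).2
      rw [← hv', proj_mk] at h1
      rw [hatt, h1]
      simp [Finsupp.linearCombination_apply]
  have hp : ∀ x, (relSubmodule r).mkQ (Finsupp.single (mk i (fun _ => (0 : A)) n c g x) 1) ∈
      LinearMap.ker (proj (A := A) r) := by
    intro x
    rw [LinearMap.mem_ker, proj_mk]
    simp [toBase]
  refine ⟨Finsupp.linearCombination S (fun x => ⟨_, hp x⟩), fun t => Subtype.ext ?_⟩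
  have h1 := mkQ_attachRel r hvalid t
  rw [attachRel, hatt, ← Submodule.Quotient.mk_eq_zero, Submodule.Quotient.mk_sub,
    sub_eq_zero] at h1
  have h2 := hv' t
  rw [Submodule.mkQ_apply] at h2
  rw [← h2, ← h1, ← Submodule.mkQ_apply, Finsupp.lmapDomain_apply, Finsupp.mapDomain,
    Finsupp.linearCombination_apply, Finsupp.sum, Finsupp.sum]
  simp only [map_sum, Submodule.coe_sum, Submodule.coe_smul]
  refine Finset.sum_congr rfl fun x _ => ?_
  rw [← map_smul, Finsupp.smul_single_one]

theorem proj_surjective (i : ι) [IsEmpty (T i)] (x : X i) :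
    Function.Surjective (proj (A := A) r) := by
  intro y
  refine ⟨(relSubmodule r).mkQ (Finsupp.single
    (mk i (fun _ => y) (fun _ => 0) (fun _ k => k.elim0) (fun _ k => k.elim0) x) 1), ?_⟩
  rw [proj_mk]
  simp [toBase]

/-- The closed set generated by a generator. -/
def closureOf : Gen S X T A → Set (Gen S X T A)
  | mk i a n c g _ => Set.range (mk i a n c g) ∪ ⋃ t, ⋃ k, closureOf (g t k)

theorem mem_closureOf (γ : Gen S X T A) : γ ∈ closureOf γ := by
  cases γ
  exact Or.inl ⟨_, rfl⟩

theorem isClosedSet_closureOf (γ : Gen S X T A) : IsClosedSet (closureOf γ) := by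
  induction γ with
  | mk i a n c g x ih =>
    constructor
    · rintro i' a' n' c' g' y y' (⟨z, hz⟩ | h)
      · cases hz
        exact Or.inl ⟨_, rfl⟩
      · simp only [Set.mem_iUnion] at h
        obtain ⟨t, k, h⟩ := h
        exact Or.inr (Set.mem_iUnion₂.2 ⟨t, k, (ih t k).cell _ _ _ _ _ _ _ h⟩)
    · rintro i' a' n' c' g' y t' k' (⟨z, hz⟩ | h)
      · cases hz
        exact Or.inr (Set.mem_iUnion₂.2 ⟨t', k', mem_closureOf _⟩)
      · simp only [Set.mem_iUnion] at h
        obtain ⟨t, k, h⟩ := h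
        exact Or.inr (Set.mem_iUnion₂.2 ⟨t, k, (ih t k).attach _ _ _ _ _ _ _ _ h⟩)

theorem isClosedSet_iUnion {J : Type*} {D : J → Set (Gen S X T A)} (h : ∀ j, IsClosedSet (D j)) :
    IsClosedSet (⋃ j, D j) := by
  constructor
  · intro i a n c g x x' hx
    obtain ⟨j, hj⟩ := Set.mem_iUnion.1 hx
    exact Set.mem_iUnion.2 ⟨j, (h j).cell _ _ _ _ _ _ _ hj⟩
  · intro i a n c g x t k hx
    obtain ⟨j, hj⟩ := Set.mem_iUnion.1 hx
    exact Set.mem_iUnion.2 ⟨j, (h j).attach _ _ _ _ _ _ _ _ hj⟩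

open Cardinal in
theorem mk_iUnion_lt {κ : Cardinal.{u}} (hκ : κ.IsRegular) {J Z : Type u} {D : J → Set Z}
    (hJ : #J < κ) (hD : ∀ j, #(D j) < κ) : #(⋃ j, D j) < κ :=
  mk_iUnion_le_sum_mk.trans_lt (sum_lt_of_isRegular hκ hJ hD)

open Cardinal in
-- A cell has fewer than `κ` generators and relations, each relation attached along finitely many
-- earlier generators; regularity carries the bound through the induction.
theorem mk_closureOf_lt {κ : Cardinal.{u}} (hκ : κ.IsRegular) (hX : ∀ i, #(X i) < κ)
    (hT : ∀ i, #(T i) < κ) (γ : Gen S X T A) : #(closureOf γ) < κ := by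
  induction γ with
  | mk i a n c g x ih =>
    refine (mk_union_le _ _).trans_lt (add_lt_of_lt hκ.aleph0_le (mk_range_le.trans_lt (hX i)) ?_)
    refine mk_iUnion_lt hκ (hT i) fun t => ?_
    rw [← (Equiv.ulift.{u} (α := Fin (n t))).surjective.iUnion_comp]
    refine mk_iUnion_lt hκ ?_ fun k => ih t _
    exact (lt_aleph0_of_finite _).trans_le hκ.aleph0_le

open Cardinal in
theorem exists_isClosedSet {κ : Cardinal.{u}} (hκ : κ.IsRegular) (hX : ∀ i, #(X i) < κ)
    (hT : ∀ i, #(T i) < κ) (s : Finset (Gen S X T A)) :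
    ∃ D : Set (Gen S X T A), IsClosedSet D ∧ #D < κ ∧ ∀ γ ∈ s, γ ∈ D := by
  refine ⟨⋃ γ : s, closureOf γ.1, isClosedSet_iUnion fun γ => isClosedSet_closureOf _,
    mk_iUnion_lt hκ ?_ fun γ => mk_closureOf_lt hκ hX hT _,
    fun γ hγ => Set.mem_iUnion.2 ⟨⟨γ, hγ⟩, mem_closureOf _⟩⟩
  exact (lt_aleph0_of_finite _).trans_le hκ.aleph0_le

/-- The attaching relations of the cell of a generator. -/
def cellRels : Gen S X T A → Set (Gen S X T A →₀ S)
  | mk _ a _ c g _ => Set.range (attachRel r a c g)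

open Cardinal in
theorem mk_cellRels_lt {κ : Cardinal.{u}} (hT : ∀ i, #(T i) < κ) (γ : Gen S X T A) :
    #(cellRels r γ) < κ := by
  cases γ
  exact mk_range_le.trans_lt (hT _)

theorem attachRel_mem_supported {D : Set (Gen S X T A)} (hD : IsClosedSet D) {i : ι} {a : X i → A}
    {n : T i → ℕ} {c : ∀ t, Fin (n t) → S} {g : ∀ t, Fin (n t) → Gen S X T A} {x : X i}
    (hx : mk i a n c g x ∈ D) (t : T i) : attachRel r a c g t ∈ Finsupp.supported S S D := by
  refine sub_mem ?_ (sum_mem fun k _ => ?_)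
  · rw [Finsupp.lmapDomain_apply, Finsupp.mapDomain]
    exact sum_mem fun y _ => Finsupp.single_mem_supported S _ (hD.cell _ _ _ _ _ _ _ hx)
  · exact Finsupp.single_mem_supported S _ (hD.attach _ _ _ _ _ _ _ _ hx)

end Gen

end Cells

/-! ### Vanishing of Ext¹ as lifting and extension properties -/

section Ext

open Abelian Limits

section

variable {C : Type*} [Category C] [Abelian C] [HasExt C] {T : ShortComplex C}

theorem exists_lift_of_shortExact (hT : T.ShortExact) {M : C} (h : Subsingleton (Ext M T.X₁ 1))
    (φ : M ⟶ T.X₃) : ∃ ψ : M ⟶ T.X₂, ψ ≫ T.g = φ := by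
  obtain ⟨y, hy⟩ := Ext.covariant_sequence_exact₃ M hT (Ext.mk₀ φ) (zero_add 1)
    (Subsingleton.elim _ _)
  obtain ⟨ψ, rfl⟩ := Ext.mk₀_bijective _ _ |>.2 y
  rw [Ext.mk₀_comp_mk₀] at hy
  exact ⟨ψ, (Ext.mk₀_bijective _ _).1 hy⟩

theorem exists_extension_of_shortExact (hT : T.ShortExact) {B : C}
    (h : Subsingleton (Ext T.X₃ B 1)) (φ : T.X₁ ⟶ B) : ∃ ψ : T.X₂ ⟶ B, T.f ≫ ψ = φ := by
  obtain ⟨y, hy⟩ := Ext.contravariant_sequence_exact₁ hT B (Ext.mk₀ φ) (add_zero 1)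
    (Subsingleton.elim _ _)
  obtain ⟨ψ, rfl⟩ := Ext.mk₀_bijective _ _ |>.2 y
  rw [Ext.mk₀_comp_mk₀] at hy
  exact ⟨ψ, (Ext.mk₀_bijective _ _).1 hy⟩

theorem subsingleton_ext_of_lifts (hT : T.ShortExact) [Injective T.X₂] {M : C}
    (h : ∀ φ : M ⟶ T.X₃, ∃ ψ : M ⟶ T.X₂, ψ ≫ T.g = φ) : Subsingleton (Ext M T.X₁ 1) := by
  refine subsingleton_of_forall_eq 0 fun x => ?_
  obtain ⟨y, rfl⟩ := Ext.covariant_sequence_exact₁ M hT x (Ext.eq_zero_of_injective _) (zero_add 1)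
  obtain ⟨φ, rfl⟩ := Ext.mk₀_bijective _ _ |>.2 y
  obtain ⟨ψ, rfl⟩ := h φ
  rw [← Ext.mk₀_comp_mk₀, Ext.comp_assoc_of_second_deg_zero, hT.comp_extClass, Ext.comp_zero]

theorem subsingleton_ext_of_extensions (hT : T.ShortExact) [Projective T.X₂] {B : C}
    (h : ∀ φ : T.X₁ ⟶ B, ∃ ψ : T.X₂ ⟶ B, T.f ≫ ψ = φ) : Subsingleton (Ext T.X₃ B 1) := by
  refine subsingleton_of_forall_eq 0 fun x => ?_
  obtain ⟨y, rfl⟩ := Ext.contravariant_sequence_exact₃ hT B x (Ext.eq_zero_of_projective _)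
    (add_zero 1)
  obtain ⟨φ, rfl⟩ := Ext.mk₀_bijective _ _ |>.2 y
  obtain ⟨ψ, rfl⟩ := h φ
  rw [← Ext.mk₀_comp_mk₀, ← Ext.comp_assoc_of_second_deg_zero, hT.extClass_comp, Ext.zero_comp]

end

variable {S : Type u} [Ring S]

theorem exists_lift {M B : ModuleCat.{u} S} {Y W : Type u} [AddCommGroup Y] [Module S Y]
    [AddCommGroup W] [Module S W] (q : Y →ₗ[S] W) (hq : Function.Surjective q)
    (e : LinearMap.ker q ≃ₗ[S] B)
    (h : Subsingleton (Ext M B 1)) (φ : M →ₗ[S] W) : ∃ ψ : M →ₗ[S] Y, q ∘ₗ ψ = φ := by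
  let T : ShortComplex (ModuleCat.{u} S) := ShortComplex.moduleCatMk
    (X₁ := B) ((LinearMap.ker q).subtype ∘ₗ e.symm.toLinearMap) q (by
      ext x
      exact (e.symm x).2)
  have hT : T.ShortExact := ModuleCat.shortComplex_shortExact _ (by
      intro x
      constructor
      · intro hx
        exact ⟨e ⟨x, hx⟩, congrArg Subtype.val (e.symm_apply_apply ⟨x, hx⟩)⟩
      · rintro ⟨y, rfl⟩
        exact (e.symm y).2)
    (Subtype.val_injective.comp e.symm.injective) hq
  obtain ⟨ψ, hψ⟩ := exists_lift_of_shortExact hT (M := M) h (ModuleCat.ofHom φ)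
  exact ⟨ψ.hom, congrArg ModuleCat.Hom.hom hψ⟩

theorem exists_extension {M B : ModuleCat.{u} S} {P : Type u} [AddCommGroup P] [Module S P]
    (p : P →ₗ[S] M) (hp : Function.Surjective p) (h : Subsingleton (Ext M B 1))
    (φ : LinearMap.ker p →ₗ[S] B) : ∃ ψ : P →ₗ[S] B, ∀ x : LinearMap.ker p, ψ x = φ x := by
  obtain ⟨ψ, hψ⟩ := exists_extension_of_shortExact (LinearMap.shortExact_shortComplexKer hp) h
    (ModuleCat.ofHom φ)
  exact ⟨ψ.hom, fun x => LinearMap.congr_fun (congrArg ModuleCat.Hom.hom hψ) x⟩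

theorem subsingleton_ext_of_exists_extension {M B : ModuleCat.{u} S} {P : Type u} [AddCommGroup P]
    [Module S P] [Module.Projective S P] (p : P →ₗ[S] M) (hp : Function.Surjective p)
    (h : ∀ φ : LinearMap.ker p →ₗ[S] B, ∃ ψ : P →ₗ[S] B, ∀ x : LinearMap.ker p, ψ x = φ x) :
    Subsingleton (Ext M B 1) := by
  have : Projective (LinearMap.shortComplexKer p).X₂ :=
    inferInstanceAs (Projective (ModuleCat.of S P))
  refine subsingleton_ext_of_extensions (LinearMap.shortExact_shortComplexKer hp) fun φ => ?_
  obtain ⟨ψ, hψ⟩ := h φ.hom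
  exact ⟨ModuleCat.ofHom ψ, by ext x; exact hψ x⟩

theorem subsingleton_ext_of_exists_lift {M B : ModuleCat.{u} S}
    (h : ∀ (Y W : Type u) [AddCommGroup Y] [Module S Y] [AddCommGroup W] [Module S W]
      (q : Y →ₗ[S] W), Function.Surjective q → Nonempty (LinearMap.ker q ≃ₗ[S] B) →
      ∀ φ : M →ₗ[S] W, ∃ ψ : M →ₗ[S] Y, q ∘ₗ ψ = φ) :
    Subsingleton (Ext M B 1) := by
  let E : ModuleCat.{u} S := Injective.under B
  let j : B →ₗ[S] E := (Injective.ι B).hom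
  have hj : Function.Injective j := (ModuleCat.mono_iff_injective (Injective.ι B)).1 inferInstance
  let q := (LinearMap.range j).mkQ
  let T : ShortComplex (ModuleCat.{u} S) := ShortComplex.moduleCatMk j q (by
    ext x
    simp [q])
  have hT : T.ShortExact := ModuleCat.shortComplex_shortExact _ (by
      intro x
      exact (Submodule.Quotient.mk_eq_zero _).trans Iff.rfl) hj (Submodule.mkQ_surjective _)
  have : Injective T.X₂ := inferInstanceAs (Injective (Injective.under B))
  refine subsingleton_ext_of_lifts hT fun φ => ?_
  obtain ⟨ψ, hψ⟩ := h _ _ q (Submodule.mkQ_surjective _)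
    ⟨(LinearEquiv.ofEq _ _ (Submodule.ker_mkQ _)).trans (LinearEquiv.ofInjective j hj).symm⟩ φ.hom
  exact ⟨ModuleCat.ofHom ψ, by ext x; exact LinearMap.congr_fun hψ x⟩

end Ext

/-! ### Closure properties of ^⊥ℬ and Wakamatsu's lemma -/

section Perp

open Abelian

variable {S : Type u} [Ring S] {ℬ : ObjectProperty (ModuleCat.{u} S)}

theorem leftPerp_iff_exists_lift {M : ModuleCat.{u} S} :
    leftPerp ℬ M ↔ ∀ B, ℬ B → ∀ (Y W : Type u) [AddCommGroup Y] [Module S Y] [AddCommGroup W]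
      [Module S W] (q : Y →ₗ[S] W), Function.Surjective q → Nonempty (LinearMap.ker q ≃ₗ[S] B) →
      ∀ φ : M →ₗ[S] W, ∃ ψ : M →ₗ[S] Y, q ∘ₗ ψ = φ :=
  ⟨fun h B hB _ _ _ _ _ _ q hq ⟨e⟩ φ => exists_lift q hq e (h B hB) φ,
    fun h B hB => subsingleton_ext_of_exists_lift (h B hB)⟩

theorem leftPerp_of_retract {M N : ModuleCat.{u} S} (i : N →ₗ[S] M) (s : M →ₗ[S] N)
    (hsi : ∀ x, s (i x) = x) (hM : leftPerp ℬ M) : leftPerp ℬ N := by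
  rw [leftPerp_iff_exists_lift] at hM ⊢
  intro B hB Y W _ _ _ _ q hq he φ
  obtain ⟨ψ, hψ⟩ := hM B hB Y W q hq he (φ ∘ₗ s)
  exact ⟨ψ ∘ₗ i, by rw [← LinearMap.comp_assoc, hψ]; ext x; simp [hsi]⟩

theorem leftPerp_of_linearEquiv {M N : ModuleCat.{u} S} (e : M ≃ₗ[S] N) (hM : leftPerp ℬ M) :
    leftPerp ℬ N :=
  leftPerp_of_retract e.symm.toLinearMap e.toLinearMap (fun x => e.apply_symm_apply x) hM

theorem subsingleton_ext_of_linearEquiv {M N B : ModuleCat.{u} S} (e : M ≃ₗ[S] N)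
    (h : Subsingleton (Ext M B 1)) : Subsingleton (Ext N B 1) :=
  leftPerp_of_linearEquiv (ℬ := fun X => X = B) e (by rintro _ rfl; exact h) B rfl

theorem leftPerp_directSum {I : Type u} (M : I → ModuleCat.{u} S) (hM : ∀ i, leftPerp ℬ (M i)) :
    leftPerp ℬ (ModuleCat.of S (DirectSum I fun i => M i)) := by
  classical
  simp only [leftPerp_iff_exists_lift] at hM ⊢
  intro B hB Y W _ _ _ _ q hq he φ
  choose ψ hψ using fun i => hM i B hB Y W q hq he (φ ∘ₗ DirectSum.lof S I (fun i => M i) i)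
  refine ⟨DirectSum.toModule S I Y ψ, DirectSum.linearMap_ext (ι := I) S fun i => ?_⟩
  rw [← hψ i]
  ext x
  simp

theorem leftPerp_of_projective (M : ModuleCat.{u} S) [Projective M] : leftPerp ℬ M :=
  fun _ _ => Ext.subsingleton_of_projective _ _ 0

theorem leftPerp_of_shortExact {T : ShortComplex (ModuleCat.{u} S)} (hT : T.ShortExact)
    (h₁ : leftPerp ℬ T.X₁) (h₃ : leftPerp ℬ T.X₃) : leftPerp ℬ T.X₂ := by
  intro B hB
  have := h₁ B hB
  have := h₃ B hB
  refine subsingleton_of_forall_eq 0 fun x => ?_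
  obtain ⟨y, rfl⟩ := Ext.contravariant_sequence_exact₂ hT B x (Subsingleton.elim _ _)
  rw [Subsingleton.elim y 0, Ext.comp_zero]

/-- Wakamatsu's lemma for modules. -/
theorem rightPerp_ker_of_isCover {A C : ModuleCat.{u} S} (f : A ⟶ C)
    (hf : IsCover (leftPerp ℬ) f) :
    rightPerp (leftPerp ℬ) (ModuleCat.of S (LinearMap.ker f.hom)) := by
  intro A' hA'
  let p : (A' →₀ S) →ₗ[S] A' := Finsupp.linearCombination S id
  have hp : Function.Surjective p := Finsupp.linearCombination_id_surjective S A'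
  refine subsingleton_ext_of_exists_extension p hp fun φ => ?_
  let φ' : LinearMap.ker p →ₗ[S] A := (LinearMap.ker f.hom).subtype ∘ₗ φ
  have hφ' : ∀ x, f.hom (φ' x) = 0 := fun x => (φ x).2
  -- The quotient by `N` is the pushout of `φ'` and `ker p ⊆ A' →₀ S`: an extension of `A'` by `A`,
  -- hence in `^⊥ℬ`.
  let N : Submodule S (A × (A' →₀ S)) := LinearMap.range (φ'.prod (-(LinearMap.ker p).subtype))
  let j : A →ₗ[S] (A × (A' →₀ S)) ⧸ N := N.mkQ ∘ₗ LinearMap.inl S A (A' →₀ S)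
  let pZ : (A × (A' →₀ S)) ⧸ N →ₗ[S] A' := N.liftQ (p ∘ₗ LinearMap.snd S A (A' →₀ S)) (by
    rintro _ ⟨x, rfl⟩
    simp)
  let fZ : (A × (A' →₀ S)) ⧸ N →ₗ[S] C := N.liftQ (f.hom ∘ₗ LinearMap.fst S A (A' →₀ S)) (by
    rintro _ ⟨x, rfl⟩
    simpa using hφ' x)
  have hglue : ∀ x : LinearMap.ker p, N.mkQ (0, (x : A' →₀ S)) = j (φ' x) := by
    intro x
    refine (Submodule.Quotient.eq _).2 ⟨-x, ?_⟩
    refine Prod.ext ((map_neg φ' x).trans ?_) ?_ <;> simp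
  have hjp : ∀ a, pZ (j a) = 0 := fun a => by simp [pZ, j]
  let T : ShortComplex (ModuleCat.{u} S) := ShortComplex.moduleCatMk j pZ (LinearMap.ext hjp)
  have hT : T.ShortExact := by
    refine ModuleCat.shortComplex_shortExact T ?_ ?_ ?_
    · intro z
      refine ⟨fun hz => ?_, ?_⟩
      · obtain ⟨⟨a, x⟩, rfl⟩ := N.mkQ_surjective z
        have hx : x ∈ LinearMap.ker p := by
          have : pZ (N.mkQ (a, x)) = 0 := hz
          simpa [pZ] using this
        refine ⟨a + φ' ⟨x, hx⟩, ?_⟩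
        change j (a + φ' ⟨x, hx⟩) = _
        rw [map_add, ← hglue]
        change N.mkQ (a, 0) + _ = _
        rw [← map_add]
        simp
      · rintro ⟨a, rfl⟩
        exact hjp a
    · refine (injective_iff_map_eq_zero j).2 fun a ha => ?_
      obtain ⟨x, hx⟩ := (Submodule.Quotient.mk_eq_zero _).1 ha
      have h2 := congrArg Prod.snd hx
      have h1 := congrArg Prod.fst hx
      have hx0 : x = 0 := by simpa using h2
      simpa [hx0] using h1.symm
    · intro a
      obtain ⟨x, rfl⟩ := hp a
      refine ⟨N.mkQ (0, x), ?_⟩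
      change pZ _ = _
      simp [pZ]
  have hZ : leftPerp ℬ T.X₂ := leftPerp_of_shortExact hT hf.1.1 hA'
  obtain ⟨u', hu⟩ := hf.1.2 _ hZ (ModuleCat.ofHom fZ)
  let u : (A × (A' →₀ S)) ⧸ N →ₗ[S] A := u'.hom
  have hu' : ∀ z, f.hom (u z) = fZ z := fun z =>
    LinearMap.congr_fun (congrArg ModuleCat.Hom.hom hu) z
  let e : A ⟶ A := ModuleCat.ofHom (u ∘ₗ j)
  have he : e ≫ f = f := by
    ext a
    exact (hu' (j a)).trans (by simp [fZ, j])
  have := hf.2 e he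
  have hef : inv e ≫ f = f := by rw [IsIso.inv_comp_eq, he]
  -- `e⁻¹u` retracts the pushout onto `A` over `C`; on the free module, where `fZ` vanishes, it
  -- takes values in `ker f`.
  let θ : (A' →₀ S) →ₗ[S] A := (inv e).hom ∘ₗ u ∘ₗ N.mkQ ∘ₗ LinearMap.inr S A (A' →₀ S)
  have hθ : ∀ x, θ x ∈ LinearMap.ker f.hom := by
    intro x
    have h1 : f.hom ((inv e).hom (u (N.mkQ (0, x)))) = f.hom (u (N.mkQ (0, x))) :=
      LinearMap.congr_fun (congrArg ModuleCat.Hom.hom hef) _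
    rw [hu'] at h1
    rw [LinearMap.mem_ker]
    refine h1.trans ?_
    simp [fZ]
  refine ⟨θ.codRestrict _ hθ, fun x => Subtype.ext ?_⟩
  change (inv e).hom (u (N.mkQ (0, (x : A' →₀ S)))) = φ' x
  rw [hglue]
  exact LinearMap.congr_fun (congrArg ModuleCat.Hom.hom (IsIso.hom_inv_id e)) (φ' x)

end Perp

/-! ### Direct limits, pure epimorphisms and Enochs' theorem -/

section Covers

open Limits

variable {S : Type u} [Ring S]

/-- The monoid of endomorphisms over a module. -/
def endOver {A M : Type u} [AddCommGroup A] [Module S A] [AddCommGroup M] [Module S M]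
    (f : A →ₗ[S] M) : Submonoid (Module.End S A) where
  carrier := {g | f ∘ₗ g = f}
  one_mem' := rfl
  mul_mem' := by
    intro a b ha hb
    rw [Set.mem_ofPred_eq] at ha hb ⊢
    rw [Module.End.mul_eq_comp, ← LinearMap.comp_assoc, ha, hb]

open Classical in
/-- The constant functor on objects given by a coherent system of endomorphisms. -/
noncomputable def systemFunctor {W : Type u} [LinearOrder W] (A : ModuleCat.{u} S)
    (e : W → W → (A →ₗ[S] A)) (he : ∀ a b c, a < b → b < c → e b c ∘ₗ e a b = e a c) :
    W ⥤ ModuleCat.{u} S where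
  obj _ := A
  map {a b} _ := if a = b then 𝟙 A else ModuleCat.ofHom (e a b)
  map_id a := if_pos rfl
  map_comp {a b c} h h' := by
    rcases (leOfHom h).eq_or_lt with rfl | hab
    · simp
    · rcases (leOfHom h').eq_or_lt with rfl | hbc
      · simp
      · rw [if_neg hab.ne, if_neg hbc.ne, if_neg (hab.trans hbc).ne, ← ModuleCat.ofHom_comp,
          he a b c hab hbc]

/-- The colimit of the system lies in `𝒜` and maps to `M`; factoring this map through the precover
gives the cocone. -/
theorem hasMonoidCocones_endOver {𝒜 : ObjectProperty (ModuleCat.{u} S)}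
    (h : IsClosedUnderDirectLimits 𝒜) {A M : ModuleCat.{u} S} (f : A ⟶ M)
    (hf : IsPrecover 𝒜 f) : HasMonoidCocones (endOver f.hom) := by
  classical
  intro W _ _ e he
  let F : W ⥤ ModuleCat.{u} S := systemFunctor A (fun a b => (e a b).1)
    (fun a b c hab hbc => congrArg Subtype.val (he a b c hab hbc))
  have hF : ∀ a b (hab : a < b), F.map (homOfLE hab.le) = ModuleCat.ofHom (e a b).1 :=
    fun a b hab => if_neg hab.ne
  have := h W
  have hcolim : 𝒜 (colimit F) := 𝒜.prop_colimit F fun _ => hf.1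
  let c : Cocone F :=
    { pt := M
      ι :=
        { app := fun _ => f
          naturality := by
            intro a b hab
            refine Eq.trans ?_ (Category.comp_id f).symm
            rcases (leOfHom hab).eq_or_lt with rfl | hlt
            · rw [Subsingleton.elim hab (𝟙 a), F.map_id]
              exact Category.id_comp f
            · rw [Subsingleton.elim hab (homOfLE hlt.le), hF a b hlt]
              ext x
              exact LinearMap.congr_fun (e a b).2 x } }
  obtain ⟨g, hg⟩ := hf.2 _ hcolim (colimit.desc F c)
  let r : ∀ a : W, A ⟶ A := fun a => colimit.ι F a ≫ g
  have hr : ∀ a, r a ≫ f = f := fun a =>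
    (Category.assoc _ _ _).trans ((congrArg (colimit.ι F a ≫ ·) hg).trans (colimit.ι_desc c a))
  refine ⟨fun a => ⟨(r a).hom, congrArg ModuleCat.Hom.hom (hr a)⟩, fun a b hab => Subtype.ext ?_⟩
  have h1 : F.map (homOfLE hab.le) ≫ r b = r a := colimit.w_assoc F (homOfLE hab.le) g
  rw [hF a b hab] at h1
  exact congrArg ModuleCat.Hom.hom h1

/-- Enochs' theorem: if a class is closed under direct limits and retracts, then a module with a
precover has a cover. -/
theorem exists_isCover_of_isPrecover {𝒜 : ObjectProperty (ModuleCat.{u} S)}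
    (h : IsClosedUnderDirectLimits 𝒜)
    (hret : ∀ (M N : ModuleCat.{u} S) (i : N →ₗ[S] M) (s : M →ₗ[S] N), (∀ x, s (i x) = x) →
      𝒜 M → 𝒜 N)
    {A M : ModuleCat.{u} S} (f : A ⟶ M) (hf : IsPrecover 𝒜 f) :
    ∃ (C : ModuleCat.{u} S) (g : C ⟶ M), IsCover 𝒜 g := by
  obtain ⟨x, hxx, hx⟩ := (hasMonoidCocones_endOver h f hf).exists_idempotent
  have hfx : ∀ a, f.hom (x.1 a) = f.hom a := LinearMap.congr_fun x.2
  have hxx' : ∀ a, x.1 (x.1 a) = x.1 a := LinearMap.congr_fun (congrArg Subtype.val hxx)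
  let A' := LinearMap.range x.1
  have hfix : ∀ a : A', x.1 a.1 = a.1 := by
    rintro ⟨_, a, rfl⟩
    exact hxx' a
  let s : A →ₗ[S] A' := x.1.rangeRestrict
  have hs : ∀ a : A', s a.1 = a := fun a => Subtype.ext (hfix a)
  refine ⟨ModuleCat.of S A', ModuleCat.ofHom (f.hom ∘ₗ A'.subtype), ⟨?_, ?_⟩, ?_⟩
  · exact hret A (ModuleCat.of S A') A'.subtype s hs hf.1
  · intro D hD g
    obtain ⟨k, hk⟩ := hf.2 D hD g
    refine ⟨k ≫ ModuleCat.ofHom s, ?_⟩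
    rw [← hk]
    ext a
    exact hfx (k.hom a)
  · intro v hv
    have hv' : ∀ a, f.hom (v.hom a).1 = f.hom a.1 :=
      LinearMap.congr_fun (congrArg ModuleCat.Hom.hom hv)
    let v' : A' →ₗ[S] A' := v.hom
    -- Endomorphisms of the image of `x` over `M` correspond to elements of `xGx`, so `v` is
    -- invertible.
    let g : endOver f.hom := ⟨A'.subtype ∘ₗ v' ∘ₗ s, by
      ext a
      exact (hv' (s a)).trans (hfx a)⟩
    have hg1 : x * g = g := by
      refine Subtype.ext (LinearMap.ext fun a => ?_)
      exact hfix (v' (s a))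
    have hg2 : g * x = g := by
      refine Subtype.ext (LinearMap.ext fun a => ?_)
      exact congrArg (fun b => (v' b).1) (hs (s a))
    obtain ⟨k, hk1, hk2, hk3, hk4⟩ := hx g hg1 hg2
    have hk1' : ∀ a : A', k.1 (v' a).1 = a.1 := by
      intro a
      have : k.1 (v' (s a.1)).1 = x.1 a.1 := LinearMap.congr_fun (congrArg Subtype.val hk1) a.1
      rwa [hs, hfix] at this
    have hk2' : ∀ a : A', (v' (s (k.1 a.1))).1 = a.1 := by
      intro a
      have : (v' (s (k.1 a.1))).1 = x.1 a.1 := LinearMap.congr_fun (congrArg Subtype.val hk2) a.1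
      rwa [hfix] at this
    rw [ConcreteCategory.isIso_iff_bijective]
    refine ⟨fun a b hab => Subtype.ext ?_, fun a => ⟨s (k.1 a.1), Subtype.ext (hk2' a)⟩⟩
    have hab' : v' a = v' b := hab
    rw [← hk1' a, ← hk1' b, hab']

/-- The finitely many generators lift to a common stage, and the finitely many relations die at a
later one. -/
theorem exists_factor_of_isColimit {I : Type u} [PartialOrder I] [IsDirectedOrder I] [Nonempty I]
    {F : I ⥤ ModuleCat.{u} S} {c : Cocone F} (hc : IsColimit c) {P : ModuleCat.{u} S}
    (hP : IsLTPresented S Cardinal.aleph0 P) (g : P ⟶ c.pt) :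
    ∃ (i : I) (k : P ⟶ F.obj i), k ≫ c.ι.app i = g := by
  obtain ⟨J, p, X, hJ, hX, hp, hker⟩ := hP
  have : Finite J := Cardinal.lt_aleph0_iff_finite.mp hJ
  have : Finite X := Cardinal.lt_aleph0_iff_finite.mp hX
  have hw : ∀ (i i' : I) (h : i ⟶ i') (a : F.obj i),
      (c.ι.app i').hom ((F.map h).hom a) = (c.ι.app i).hom a := fun i i' h a =>
    LinearMap.congr_fun (congrArg ModuleCat.Hom.hom (c.w h)) a
  choose i y hy using fun j : J =>
    Concrete.isColimit_exists_rep F hc (g.hom (p (Finsupp.single j 1)))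
  obtain ⟨m, hm⟩ := Finite.exists_le i
  let α : (J →₀ S) →ₗ[S] F.obj m :=
    Finsupp.linearCombination S fun j => (F.map (homOfLE (hm j))).hom (y j)
  have hα : (c.ι.app m).hom ∘ₗ α = g.hom ∘ₗ p := by
    ext j
    simp only [α, LinearMap.comp_apply, Finsupp.lsingle_apply, Finsupp.linearCombination_single,
      one_smul, hw]
    exact hy j
  have hrel : ∀ v : X, ∃ (n : I) (h : m ⟶ n), (F.map h).hom (α v) = 0 := by
    intro v
    have h0 : (c.ι.app m).hom (α v) = (c.ι.app m).hom 0 := by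
      have h1 : (v : J →₀ S) ∈ LinearMap.ker p := hker ▸ Submodule.subset_span v.2
      have h2 := LinearMap.congr_fun hα v
      rw [LinearMap.comp_apply, LinearMap.comp_apply, LinearMap.mem_ker.1 h1, map_zero] at h2
      rw [h2, map_zero]
    obtain ⟨n, h, h', heq⟩ := Concrete.isColimit_exists_of_rep_eq F hc _ _ h0
    exact ⟨n, h, heq.trans (map_zero (F.map h').hom)⟩
  choose n h hn using hrel
  obtain ⟨l, hl⟩ := Finite.exists_le n
  obtain ⟨l', hml, hll⟩ := exists_ge_ge m l
  let β : (J →₀ S) →ₗ[S] F.obj l' := (F.map (homOfLE hml)).hom ∘ₗ α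
  have hβ : LinearMap.ker p ≤ LinearMap.ker β := by
    rw [← hker, Submodule.span_le]
    intro v hv
    have h1 : homOfLE hml = h ⟨v, hv⟩ ≫ homOfLE ((hl ⟨v, hv⟩).trans hll) :=
      Subsingleton.elim _ _
    change (F.map (homOfLE hml)).hom (α v) = 0
    rw [h1, F.map_comp, ModuleCat.hom_comp, LinearMap.comp_apply, hn ⟨v, hv⟩, map_zero]
  let k : P →ₗ[S] F.obj l' :=
    (LinearMap.ker p).liftQ β hβ ∘ₗ (p.quotKerEquivOfSurjective hp).symm.toLinearMap
  have hk : ∀ v, k (p v) = β v := by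
    intro v
    have : (p.quotKerEquivOfSurjective hp).symm (p v) = (LinearMap.ker p).mkQ v := by
      rw [LinearEquiv.symm_apply_eq]
      rfl
    simp only [k, LinearMap.comp_apply, LinearEquiv.coe_coe, this]
    rfl
  refine ⟨l', ModuleCat.ofHom k, ?_⟩
  ext z
  obtain ⟨v, rfl⟩ := hp z
  change (c.ι.app l').hom (k (p v)) = g.hom (p v)
  rw [hk]
  exact (hw m l' (homOfLE hml) (α v)).trans (LinearMap.congr_fun hα v)

theorem isClosedUnderDirectLimits_of_pureEpiImages {ℬ : ObjectProperty (ModuleCat.{u} S)}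
    (h : IsClosedUnderPureEpiImages Cardinal.aleph0 (leftPerp ℬ)) :
    IsClosedUnderDirectLimits (leftPerp ℬ) := by
  classical
  intro I _ _ _
  refine ⟨fun Z => ?_⟩
  rintro ⟨⟨⟨F, τ, hc⟩, hF⟩⟩
  let φ : ∀ i, F.obj i →ₗ[S] Z := fun i => (τ.app i).hom
  let π : DirectSum I (fun i => F.obj i) →ₗ[S] Z := DirectSum.toModule S I Z φ
  have hπ : ∀ i (a : F.obj i), π (DirectSum.lof S I (fun i => F.obj i) i a) = φ i a :=
    fun i a => by simp only [π, DirectSum.toModule_lof]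
  refine h (ModuleCat.of S (DirectSum I fun i => F.obj i)) Z (ModuleCat.ofHom π) ⟨?_, ?_⟩
    (leftPerp_directSum _ hF)
  · rw [ModuleCat.epi_iff_surjective]
    intro z
    obtain ⟨i, a, rfl⟩ := Concrete.isColimit_exists_rep F hc z
    exact ⟨_, hπ i a⟩
  · intro P hP g
    obtain ⟨i, k, hk⟩ := exists_factor_of_isColimit hc hP g
    refine ⟨k ≫ ModuleCat.ofHom (DirectSum.lof S I (fun i => F.obj i) i), ?_⟩
    rw [← hk]
    ext a
    exact hπ i (k.hom a)

end Covers

/-! ### The complex with cells from `<κ`-presented modules in ^⊥ℬ -/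

section Presentations

variable {S : Type u} [Ring S]

/-- `<κ`-presentations of modules in `^⊥ℬ`. -/
structure Pres (κ : Cardinal.{u}) (ℬ : ObjectProperty (ModuleCat.{u} S)) : Type u where
  /-- the generators -/
  gens : Set κ.out
  /-- the relations -/
  rels : Set (gens →₀ S)
  mk_gens_lt : Cardinal.mk gens < κ
  mk_rels_lt : Cardinal.mk rels < κ
  mem : leftPerp ℬ (ModuleCat.of S ((gens →₀ S) ⧸ Submodule.span S rels))

variable {κ : Cardinal.{u}} {ℬ : ObjectProperty (ModuleCat.{u} S)}

namespace Pres

/-- The relations of a presentation as a family. -/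
def rel (i : Pres κ ℬ) (t : i.rels) : i.gens →₀ S := t.1

theorem span_range_rel (i : Pres κ ℬ) :
    Submodule.span S (Set.range i.rel) = Submodule.span S i.rels :=
  congrArg _ Subtype.range_coe

end Pres

/-- The generators of the cell complex over `A` with cells given by presentations. -/
abbrev PresGen (κ : Cardinal.{u}) (ℬ : ObjectProperty (ModuleCat.{u} S)) (A : Type u) : Type u :=
  Gen S (fun i : Pres κ ℬ => i.gens) (fun i : Pres κ ℬ => i.rels) A

theorem exists_linearMap_span {T P K : Type u} [AddCommGroup P] [Module S P] [AddCommGroup K]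
    [Module S K] (r : T → P) (d : T → K)
    (h : ∀ z : T →₀ S, Finsupp.linearCombination S r z = 0 → Finsupp.linearCombination S d z = 0) :
    ∃ δ : Submodule.span S (Set.range r) →ₗ[S] K,
      ∀ t, δ ⟨r t, Submodule.subset_span ⟨t, rfl⟩⟩ = d t := by
  let L := Finsupp.linearCombination S r
  let D := Finsupp.linearCombination S d
  have hLD : LinearMap.ker L ≤ LinearMap.ker D := h
  let e := LinearEquiv.ofEq _ _ (Finsupp.range_linearCombination (v := r) S)
  refine ⟨(LinearMap.ker L).liftQ D hLD ∘ₗ L.quotKerEquivRange.symm.toLinearMap ∘ₗ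
    e.symm.toLinearMap, fun t => ?_⟩
  have h1 : L.quotKerEquivRange.symm (e.symm ⟨r t, Submodule.subset_span ⟨t, rfl⟩⟩) =
      (LinearMap.ker L).mkQ (Finsupp.single t 1) := by
    rw [LinearEquiv.symm_apply_eq, LinearEquiv.symm_apply_eq]
    refine Subtype.ext ?_
    change r t = L (Finsupp.single t 1)
    simp [L]
  simp only [LinearMap.comp_apply, LinearEquiv.coe_coe, h1]
  change D (Finsupp.single t 1) = d t
  simp [D]

/-- Lift `w` by freeness. Its error on the relations takes values in `ker q ≅ B` and extends to the
free module because `Ext¹` vanishes; adding this extension corrects the lift. -/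
theorem Pres.liftsExtend {B : ModuleCat.{u} S} (hB : ℬ B) {Y W : Type u} [AddCommGroup Y]
    [Module S Y] [AddCommGroup W] [Module S W] (q : Y →ₗ[S] W) (hq : Function.Surjective q)
    (e : LinearMap.ker q ≃ₗ[S] B) :
    Gen.LiftsExtend (fun i : Pres κ ℬ => i.rel) q := by
  intro i w v hz hv
  obtain ⟨w', hw'⟩ := Module.projective_lifting_property q w hq
  have hw'' : ∀ y, q (w' y) = w y := LinearMap.congr_fun hw'
  let d : i.rels → LinearMap.ker q := fun t =>
    ⟨v t - w' (i.rel t), by rw [LinearMap.mem_ker, map_sub, hv, hw'', sub_self]⟩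
  have hd : (LinearMap.ker q).subtype ∘ₗ Finsupp.linearCombination S d =
      Finsupp.linearCombination S v - w' ∘ₗ Finsupp.linearCombination S i.rel := by
    ext t
    simp [d]
  obtain ⟨δ, hδ⟩ := exists_linearMap_span i.rel d fun z hz' => Subtype.ext (by
    have := LinearMap.congr_fun hd z
    rw [LinearMap.sub_apply, LinearMap.comp_apply, LinearMap.comp_apply, hz', hz z hz', map_zero,
      sub_zero] at this
    exact this)
  let N := Submodule.span S i.rels
  let ε : LinearMap.ker N.mkQ ≃ₗ[S] Submodule.span S (Set.range i.rel) :=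
    LinearEquiv.ofEq _ _ (by rw [Submodule.ker_mkQ, i.span_range_rel])
  obtain ⟨ψ, hψ⟩ := exists_extension (M := ModuleCat.of S ((i.gens →₀ S) ⧸ N)) N.mkQ
    N.mkQ_surjective (i.mem B hB) (e.toLinearMap ∘ₗ δ ∘ₗ ε.toLinearMap)
  refine ⟨w' + (LinearMap.ker q).subtype ∘ₗ e.symm.toLinearMap ∘ₗ ψ, ?_, fun t => ?_⟩
  · ext y
    simp only [LinearMap.comp_apply, LinearMap.add_apply, map_add, hw'']
    rw [add_eq_left]
    exact (e.symm _).2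
  · have hmem : i.rel t ∈ LinearMap.ker N.mkQ := by
      rw [Submodule.ker_mkQ]
      exact Submodule.subset_span t.2
    have h1 : ψ (i.rel t) = e (δ (ε ⟨i.rel t, hmem⟩)) := hψ ⟨i.rel t, hmem⟩
    have h2 : δ (ε ⟨i.rel t, hmem⟩) = d t := hδ t
    simp only [LinearMap.add_apply, LinearMap.comp_apply, LinearEquiv.coe_coe, h1, h2,
      LinearEquiv.symm_apply_apply]
    simp [d]

theorem Pres.subsingleton_ext {A : Type u} [AddCommGroup A] [Module S A] (i : Pres κ ℬ) :
    Subsingleton (Abelian.Ext (ModuleCat.of S ((i.gens →₀ S) ⧸ Submodule.span S i.rels))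
      (ModuleCat.of S (LinearMap.ker (Gen.proj (A := A) fun i : Pres κ ℬ => i.rel))) 1) := by
  refine subsingleton_ext_of_exists_extension (Submodule.span S i.rels).mkQ
    (Submodule.mkQ_surjective _) fun φ => ?_
  have hmem : ∀ t, i.rel t ∈ LinearMap.ker (Submodule.span S i.rels).mkQ := fun t => by
    rw [Submodule.ker_mkQ]
    exact Submodule.subset_span t.2
  let v : i.rels → LinearMap.ker (Gen.proj (A := A) fun i : Pres κ ℬ => i.rel) :=
    fun t => φ ⟨i.rel t, hmem t⟩
  obtain ⟨ψ, hψ⟩ := Gen.exists_extend_ker (A := A) (fun i : Pres κ ℬ => i.rel) i v (by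
    intro z hz
    have h1 : Finsupp.linearCombination S v = φ ∘ₗ
        Finsupp.linearCombination S (fun t => (⟨i.rel t, hmem t⟩ :
          LinearMap.ker (Submodule.span S i.rels).mkQ)) := by
      ext t
      simp [v]
    have h2 : Finsupp.linearCombination S (fun t => (⟨i.rel t, hmem t⟩ :
          LinearMap.ker (Submodule.span S i.rels).mkQ)) z = 0 := by
      have h3 : (LinearMap.ker (Submodule.span S i.rels).mkQ).subtype ∘ₗ
          Finsupp.linearCombination S (fun t => (⟨i.rel t, hmem t⟩ :
            LinearMap.ker (Submodule.span S i.rels).mkQ)) =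
          Finsupp.linearCombination S i.rel := by
        ext t
        simp
      exact Subtype.ext ((LinearMap.congr_fun h3 z).trans hz)
    rw [h1, LinearMap.comp_apply, h2, map_zero])
  refine ⟨ψ, ?_⟩
  have key : ∀ x (hx : x ∈ Submodule.span S i.rels)
      (hx' : x ∈ LinearMap.ker (Submodule.span S i.rels).mkQ), ψ x = φ ⟨x, hx'⟩ := by
    intro x hx
    induction hx using Submodule.span_induction with
    | mem x hx => exact fun _ => hψ ⟨x, hx⟩
    | zero => exact fun hx' => (map_zero ψ).trans (map_zero φ).symm
    | add x y hx hy ihx ihy =>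
      intro hxy
      rw [← Submodule.ker_mkQ (Submodule.span S i.rels)] at hx hy
      rw [map_add, ihx hx, ihy hy]
      exact (map_add φ ⟨x, hx⟩ ⟨y, hy⟩).symm
    | smul s x hx ih =>
      intro hsx
      rw [← Submodule.ker_mkQ (Submodule.span S i.rels)] at hx
      rw [map_smul, ih hx]
      exact (map_smul φ s ⟨x, hx⟩).symm
  intro x
  exact key x.1 (by simpa using x.2) x.2

/-- Embedding the generators in `κ.out` shows that the small type `Pres κ ℬ` represents all such
modules up to isomorphism. -/
theorem exists_pres {M : ModuleCat.{u} S} (hM : IsLTPresented S κ M) (h : leftPerp ℬ M) :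
    ∃ i : Pres κ ℬ, Nonempty (((i.gens →₀ S) ⧸ Submodule.span S i.rels) ≃ₗ[S] M) := by
  obtain ⟨I, f, X, hI, hX, hf, hker⟩ := hM
  have : Nonempty (I ↪ κ.out) := by
    rw [← Cardinal.le_def, Cardinal.mk_out]
    exact hI.le
  obtain ⟨j⟩ := this
  let e : (I →₀ S) ≃ₗ[S] (Set.range j →₀ S) :=
    Finsupp.domLCongr (Equiv.ofInjective j j.injective)
  let g : (Set.range j →₀ S) →ₗ[S] M := f ∘ₗ e.symm.toLinearMap
  have hg : Function.Surjective g := hf.comp e.symm.surjective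
  have hspan : Submodule.span S (e '' X) = LinearMap.ker g := by
    have h1 : Submodule.span S (e '' X) = (Submodule.span S X).map e.toLinearMap :=
      Submodule.span_image e.toLinearMap
    rw [h1, hker]
    ext x
    simp only [Submodule.mem_map, LinearMap.mem_ker, g, LinearMap.comp_apply, LinearEquiv.coe_coe]
    exact ⟨by rintro ⟨y, hy, rfl⟩; simpa using hy, fun hx => ⟨e.symm x, hx, by simp⟩⟩
  let ε : ((Set.range j →₀ S) ⧸ Submodule.span S (e '' X)) ≃ₗ[S] M :=
    (Submodule.quotEquivOfEq _ _ hspan).trans (g.quotKerEquivOfSurjective hg)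
  exact ⟨⟨Set.range j, e '' X, Cardinal.mk_range_le.trans_lt hI,
    Cardinal.mk_image_le.trans_lt hX,
    leftPerp_of_linearEquiv (M := M) (N := ModuleCat.of S _) ε.symm h⟩, ⟨ε⟩⟩

theorem rightPerp_ker_proj {𝒢 : ObjectProperty (ModuleCat.{u} S)}
    (h𝒢 : ∀ M, 𝒢 M → IsLTPresented S κ M) (h : ∀ M, 𝒢 M → leftPerp ℬ M) {A : Type u}
    [AddCommGroup A] [Module S A] :
    rightPerp 𝒢 (ModuleCat.of S
      (LinearMap.ker (Gen.proj (A := A) fun i : Pres κ ℬ => i.rel))) := by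
  intro G hG
  obtain ⟨i, ⟨e⟩⟩ := exists_pres (h𝒢 G hG) (h G hG)
  exact subsingleton_ext_of_linearEquiv
    (M := ModuleCat.of S ((i.gens →₀ S) ⧸ Submodule.span S i.rels)) e i.subsingleton_ext

theorem leftPerp_complex {A : Type u} [AddCommGroup A] [Module S A] :
    leftPerp ℬ (ModuleCat.of S (Gen.Complex (A := A) fun i : Pres κ ℬ => i.rel)) := by
  rw [leftPerp_iff_exists_lift]
  intro B hB Y W _ _ _ _ q hq ⟨e⟩ φ
  obtain ⟨ψ, hψ, -⟩ := Gen.exists_extend (D := ∅) (v₀ := 0) (fun i : Pres κ ℬ => i.rel) hq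
    (Pres.liftsExtend hB q hq e) φ ⟨by simp, by simp⟩ (by simp) (by simp)
  exact ⟨ψ, hψ⟩

theorem proj_pres_surjective (hκ : κ.IsRegular) {A : Type u} [AddCommGroup A] [Module S A] :
    Function.Surjective (Gen.proj (A := A) fun i : Pres κ ℬ => i.rel) := by
  have hκ0 : Nonempty κ.out := by
    rw [← Cardinal.mk_ne_zero_iff, Cardinal.mk_out]
    exact hκ.ne_zero
  obtain ⟨o⟩ := hκ0
  let e := (Submodule.quotEquivOfEqBot (Submodule.span S (∅ : Set (({o} : Set κ.out) →₀ S)))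
    Submodule.span_empty)
  let i : Pres κ ℬ :=
    { gens := {o}
      rels := ∅
      mk_gens_lt := (Cardinal.lt_aleph0_of_finite _).trans_le hκ.aleph0_le
      mk_rels_lt := (Cardinal.lt_aleph0_of_finite _).trans_le hκ.aleph0_le
      mem := leftPerp_of_linearEquiv (M := ModuleCat.of S (({o} : Set κ.out) →₀ S)) e.symm
        (leftPerp_of_projective _) }
  have : IsEmpty i.rels := inferInstanceAs (IsEmpty (∅ : Set (({o} : Set κ.out) →₀ S)))
  exact Gen.proj_surjective _ i (⟨o, rfl⟩ : ({o} : Set κ.out))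

/-- Elements of a `κ`-pure kernel in `ℬ` are fixed by some homomorphism from the module to the
kernel. -/
theorem exists_hom_ker_apply_eq (hκ : κ.IsRegular) {A C : ModuleCat.{u} S} (f : A ⟶ C)
    (hf : ∀ F : ModuleCat.{u} S, IsLTPresented S κ F → ∀ g : F ⟶ C, ∃ h : F ⟶ A, h ≫ f = g)
    (hK : ℬ (ModuleCat.of S (LinearMap.ker f.hom)))
    (s : A →ₗ[S] Gen.Complex (A := A) fun i : Pres κ ℬ => i.rel)
    (hs : ∀ a, Gen.proj (A := A) _ (s a) = a) (x : LinearMap.ker f.hom) :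
    ∃ g : A →ₗ[S] LinearMap.ker f.hom, g x = x := by
  classical
  let r := fun i : Pres κ ℬ => i.rel
  obtain ⟨y, hy⟩ := (Gen.relSubmodule (A := A) r).mkQ_surjective (s x)
  obtain ⟨D, hD, hDκ, hyD⟩ := Gen.exists_isClosedSet hκ
    (fun i : Pres κ ℬ => i.mk_gens_lt) (fun i : Pres κ ℬ => i.mk_rels_lt) y.support
  let p : (PresGen κ ℬ A →₀ S) →ₗ[S] A := Finsupp.linearCombination S Gen.toBase
  have hp : ∀ v ∈ Gen.relSubmodule (A := A) r, p v = 0 := fun v hv =>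
    Gen.relSubmodule_le_ker r hv
  have hpy : p y = x := by
    rw [← hs x, ← hy, Gen.proj_mk]
  let ν : (D →₀ S) →ₗ[S] (PresGen κ ℬ A →₀ S) := Finsupp.lmapDomain S S Subtype.val
  have hν : Function.Injective ν := Finsupp.mapDomain_injective Subtype.val_injective
  have hrange : ∀ v ∈ Finsupp.supported S S D, ∃ u, ν u = v := by
    intro v hv
    have h1 := Finsupp.lmapDomain_supported S S (Subtype.val : D → _) Set.univ
    rw [Set.image_univ, Subtype.range_coe] at h1
    rw [← h1] at hv
    obtain ⟨u, -, hu⟩ := hv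
    exact ⟨u, hu⟩
  let Z : Set (PresGen κ ℬ A →₀ S) := ⋃ γ : D, Gen.cellRels r γ.1
  have hZ : Cardinal.mk Z < κ := Gen.mk_iUnion_lt hκ hDκ fun γ =>
    Gen.mk_cellRels_lt r (fun i => i.mk_rels_lt) _
  -- Cells in `D` need not be valid, so only those attaching relations that hold in the complex are
  -- imposed, along with `y`.
  let X : Set (D →₀ S) := ν ⁻¹' (insert y (Z ∩ {v | v ∈ Gen.relSubmodule (A := A) r}))
  have hX : Cardinal.mk X < κ := by
    refine (Cardinal.mk_preimage_of_injective _ _ hν).trans_lt ?_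
    refine Cardinal.mk_insert_le.trans_lt (Cardinal.add_lt_of_lt hκ.aleph0_le ?_ ?_)
    · exact (Cardinal.mk_le_mk_of_subset Set.inter_subset_left).trans_lt hZ
    · exact Cardinal.one_lt_aleph0.trans_le hκ.aleph0_le
  let N := Submodule.span S X
  have hF : IsLTPresented S κ ((D →₀ S) ⧸ N) :=
    ⟨D, N.mkQ, X, hDκ, hX, N.mkQ_surjective, (Submodule.ker_mkQ N).symm⟩
  let g₀ : (D →₀ S) ⧸ N →ₗ[S] C := N.liftQ (f.hom ∘ₗ p ∘ₗ ν) (by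
    rw [Submodule.span_le]
    intro u hu
    change f.hom (p (ν u)) = 0
    rcases hu with hu | hu
    · rw [hu, hpy]
      exact x.2
    · rw [hp _ hu.2, map_zero])
  obtain ⟨h₀, hh₀⟩ := hf (ModuleCat.of S _) hF (ModuleCat.ofHom g₀)
  let h : (D →₀ S) →ₗ[S] A := h₀.hom ∘ₗ N.mkQ
  have hfh : ∀ u, f.hom (h u) = f.hom (p (ν u)) := fun u =>
    LinearMap.congr_fun (congrArg ModuleCat.Hom.hom hh₀) (N.mkQ u)
  have hhX : ∀ u ∈ X, h u = 0 := by
    intro u hu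
    have : N.mkQ u = 0 := (Submodule.Quotient.mk_eq_zero _).2 (Submodule.subset_span hu)
    change h₀.hom (N.mkQ u) = 0
    rw [this, map_zero]
  -- Both `p` and `h` kill the relations of the complex in `X`, but only `h` kills `y`; so `δ`
  -- descends to the subcomplex and sends `y` to `x`.
  let δ : (D →₀ S) →ₗ[S] LinearMap.ker f.hom := (p ∘ₗ ν - h).codRestrict _ fun u => by
    rw [LinearMap.mem_ker, LinearMap.sub_apply, map_sub, hfh]
    exact sub_self _
  let v₀ : PresGen κ ℬ A → LinearMap.ker f.hom := fun γ =>
    if hγ : γ ∈ D then δ (Finsupp.single ⟨γ, hγ⟩ 1) else 0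
  have hv₀ : ∀ u, Finsupp.linearCombination S v₀ (ν u) = δ u := by
    refine LinearMap.congr_fun (f := Finsupp.linearCombination S v₀ ∘ₗ ν) ?_
    ext1 γ
    ext1
    simp [ν, v₀]
  have hδ : ∀ u ∈ X, (δ u : A) = p (ν u) := by
    intro u hu
    change p (ν u) - h u = _
    rw [hhX u hu, sub_zero]
  obtain ⟨ψ, -, hψ⟩ := Gen.exists_extend (D := D) (v₀ := v₀) r
    (q := (0 : LinearMap.ker f.hom →ₗ[S] PUnit.{u + 1})) (fun _ => ⟨0, rfl⟩)
    (Pres.liftsExtend hK _ (fun _ => ⟨0, rfl⟩)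
      (LinearEquiv.ofTop _ LinearMap.ker_zero)) 0 hD (fun _ _ => rfl) (by
      intro i a n c g z hz hvalid t
      have h1 : Gen.attachRel r a c g t ∈ Finsupp.supported S S D :=
        Gen.attachRel_mem_supported r hD hz t
      obtain ⟨u, hu⟩ := hrange _ h1
      have h2 : Gen.attachRel r a c g t ∈ Gen.relSubmodule r := Gen.mkQ_attachRel r hvalid t
      have h3 : u ∈ X := by
        refine Or.inr ⟨?_, ?_⟩
        · rw [hu]
          exact Set.mem_iUnion.2 ⟨⟨_, hz⟩, ⟨t, rfl⟩⟩
        · rw [hu]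
          exact h2
      rw [← hu, hv₀]
      refine Subtype.ext ?_
      rw [hδ u h3, hu, hp _ h2]
      rfl)
  obtain ⟨u, hu⟩ := hrange y hyD
  have hψ' : ∀ u, ψ ((Gen.relSubmodule r).mkQ (ν u)) = δ u := by
    refine LinearMap.congr_fun (f := ψ ∘ₗ (Gen.relSubmodule r).mkQ ∘ₗ ν) ?_
    ext1 γ
    ext1
    have := hψ γ.1 γ.2
    simpa [ν, v₀] using this
  refine ⟨ψ ∘ₗ s, ?_⟩
  rw [LinearMap.comp_apply, ← hy, ← hu, hψ']
  refine Subtype.ext ?_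
  rw [hδ u (Or.inl hu), hu, hpy]

theorem section_of_leftPerp {A : ModuleCat.{u} S} (hA : leftPerp ℬ A) (hκ : κ.IsRegular)
    (hker : ℬ (ModuleCat.of S (LinearMap.ker (Gen.proj (A := A) fun i : Pres κ ℬ => i.rel)))) :
    ∃ s : A →ₗ[S] Gen.Complex (A := A) fun i : Pres κ ℬ => i.rel,
      ∀ a, Gen.proj (A := A) _ (s a) = a := by
  obtain ⟨s, hs⟩ := exists_lift (M := A) (Gen.proj (A := A) fun i : Pres κ ℬ => i.rel)
    (proj_pres_surjective hκ)
    (LinearEquiv.refl S _ : _ ≃ₗ[S] ModuleCat.of S (LinearMap.ker (Gen.proj _)))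
    (hA _ hker) LinearMap.id
  exact ⟨s, LinearMap.congr_fun hs⟩

end Presentations

/-! ### The two implications for cotorsion pairs -/

section Main

variable {S : Type u} [Ring S] {κ : Cardinal.{u}} {𝒢 𝒜 ℬ : ObjectProperty (ModuleCat.{u} S)}

theorem IsCotorsionPairGeneratedBy.leftPerp_of_mem (h : IsCotorsionPairGeneratedBy 𝒢 𝒜 ℬ)
    (M : ModuleCat.{u} S) (hM : 𝒢 M) : leftPerp ℬ M := by
  intro B hB
  rw [h.2] at hB
  exact hB M hM

theorem IsCotorsionPairGeneratedBy.ker_proj_mem (h : IsCotorsionPairGeneratedBy 𝒢 𝒜 ℬ)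
    (h𝒢 : ∀ M, 𝒢 M → IsLTPresented S κ M) (A : ModuleCat.{u} S) :
    ℬ (ModuleCat.of S (LinearMap.ker (Gen.proj (A := A) fun i : Pres κ ℬ => i.rel))) := by
  have := rightPerp_ker_proj (A := A) h𝒢 h.leftPerp_of_mem
  rwa [← h.2] at this

theorem isClosedUnderPureEpiImages_of_isCovering (hκ : κ.IsRegular)
    (h𝒢 : ∀ M, 𝒢 M → IsLTPresented S κ M) (h : IsCotorsionPairGeneratedBy 𝒢 𝒜 ℬ)
    (hcov : IsCovering 𝒜) : IsClosedUnderPureEpiImages κ 𝒜 := by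
  obtain rfl := h.1.2
  intro B C π hπ hB
  obtain ⟨A, f, hf⟩ := hcov C
  obtain ⟨b, hb⟩ := hf.1.2 B hB π
  have := hπ.1
  have hfepi : Epi f := epi_of_epi_fac hb
  have hK : ℬ (ModuleCat.of S (LinearMap.ker f.hom)) := by
    have := rightPerp_ker_of_isCover f hf
    rwa [h.1.1] at this
  obtain ⟨s, hs⟩ := section_of_leftPerp hf.1.1 hκ (h.ker_proj_mem h𝒢 A)
  have hzero : ∀ x ∈ LinearMap.ker f.hom, x = 0 := by
    intro x hx
    obtain ⟨g, hg⟩ := exists_hom_ker_apply_eq hκ f (fun F hF k => by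
      obtain ⟨l, hl⟩ := hπ.2 F hF k
      exact ⟨l ≫ b, by rw [Category.assoc, hb, hl]⟩) hK s hs ⟨x, hx⟩
    let e : A →ₗ[S] A := LinearMap.id - (LinearMap.ker f.hom).subtype ∘ₗ g
    have he : ModuleCat.ofHom e ≫ f = f := by
      ext a
      have h1 : f.hom (g a) = 0 := (g a).2
      change f.hom (a - g a) = f.hom a
      rw [map_sub, h1, sub_zero]
    have := hf.2 _ he
    have hinj := ((ConcreteCategory.isIso_iff_bijective (ModuleCat.ofHom e)).1 this).1
    apply hinj
    change x - (g x : A) = e 0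
    rw [map_zero, hg, sub_self]
  have hinj : Function.Injective f.hom := (injective_iff_map_eq_zero f.hom).2 hzero
  have hsurj : Function.Surjective f.hom := (ModuleCat.epi_iff_surjective f).1 hfepi
  exact leftPerp_of_linearEquiv (LinearEquiv.ofBijective f.hom ⟨hinj, hsurj⟩) hf.1.1

theorem isCovering_of_isClosedUnderDirectLimits (hκ : κ.IsRegular)
    (h𝒢 : ∀ M, 𝒢 M → IsLTPresented S κ M) (h : IsCotorsionPairGeneratedBy 𝒢 𝒜 ℬ)
    (hlim : IsClosedUnderDirectLimits 𝒜) : IsCovering 𝒜 := by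
  obtain rfl := h.1.2
  intro M
  let p := Gen.proj (A := M) fun i : Pres κ ℬ => i.rel
  refine exists_isCover_of_isPrecover hlim (fun M N i s hsi hM => leftPerp_of_retract i s hsi hM)
    (A := ModuleCat.of S (Gen.Complex (A := M) fun i : Pres κ ℬ => i.rel)) (ModuleCat.ofHom p)
    ⟨leftPerp_complex, fun D hD g => ?_⟩
  obtain ⟨ψ, hψ⟩ := leftPerp_iff_exists_lift.1 hD _ (h.ker_proj_mem h𝒢 M) _ _ p
    (proj_pres_surjective hκ) ⟨LinearEquiv.refl S _⟩ g.hom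
  exact ⟨ModuleCat.ofHom ψ, by ext a; exact LinearMap.congr_fun hψ a⟩

end Main

end CotorsionPairs

open CotorsionPairs in
/-- Right `R`-modules are modules over the opposite ring `Rᵐᵒᵖ`. -/
theorem corollary2p4 (R : Type u) [Ring R] :
    (∀ (κ : Cardinal.{u}) (_ : κ.IsRegular) (𝒢 𝒜 ℬ : ObjectProperty (ModuleCat.{u} Rᵐᵒᵖ)),
      (∀ M : ModuleCat.{u} Rᵐᵒᵖ, 𝒢 M → IsLTPresented Rᵐᵒᵖ κ M) →
      IsCotorsionPairGeneratedBy 𝒢 𝒜 ℬ →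
      IsCovering 𝒜 →
      IsClosedUnderPureEpiImages κ 𝒜) ∧
    (∀ 𝒢 𝒜 ℬ : ObjectProperty (ModuleCat.{u} Rᵐᵒᵖ),
      (∀ M : ModuleCat.{u} Rᵐᵒᵖ, 𝒢 M → Module.FinitePresentation Rᵐᵒᵖ M) →
      IsCotorsionPairGeneratedBy 𝒢 𝒜 ℬ →
      (IsCovering 𝒜 ↔ IsClosedUnderPureEpiImages Cardinal.aleph0 𝒜) ∧
      (IsClosedUnderPureEpiImages Cardinal.aleph0 𝒜 ↔ IsClosedUnderDirectLimits 𝒜)) := by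
  refine ⟨fun κ hκ 𝒢 𝒜 ℬ h𝒢 h hcov => isClosedUnderPureEpiImages_of_isCovering hκ h𝒢 h hcov,
    fun 𝒢 𝒜 ℬ h𝒢 h => ?_⟩
  have hκ := Cardinal.isRegular_aleph0
  have h𝒢' : ∀ M, 𝒢 M → IsLTPresented Rᵐᵒᵖ Cardinal.aleph0 M :=
    fun M hM => (isLTPresented_aleph0_iff _ M).2 (h𝒢 M hM)
  have h₁ := isClosedUnderPureEpiImages_of_isCovering hκ h𝒢' h
  have h₂ : IsClosedUnderPureEpiImages Cardinal.aleph0 𝒜 → IsClosedUnderDirectLimits 𝒜 := by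
    rw [← h.1.2]
    exact isClosedUnderDirectLimits_of_pureEpiImages
  have h₃ := isCovering_of_isClosedUnderDirectLimits hκ h𝒢' h
  exact ⟨⟨h₁, fun hp => h₃ (h₂ hp)⟩, ⟨h₂, fun hl => h₁ (h₃ hl)⟩⟩
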